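/- Let $F$ be a finite extension of $\mathbb{Q}_p$ with ring of integers $\mathcal{O}$, uniformizer $\pi$ and residue field with $q$ elements, and let $K\supseteq F$ be an algebraically closed field, complete for a real-valued valuation $v$ extending that of $F$ and normalized by $v(\pi)=1$. Let $H$ be a one-dimensional formal $\mathcal{O}$-module of $\mathcal{O}$-height $n$ over $\mathcal{O}_K$, given by a formal group law with power series $[a](T)=aT+\cdots$ for $a\in\mathcal{O}$. Its points $\widehat H(\mathcal{O}_K)$ are the $x\in\mathcal{O}_K$ with $v(x)>0$. Let $$V=V_p(H)=\{(x_i)_{i\in\mathbb{Z}} \mid x_i\in\widehat H(\mathcal{O}_K),\ \pi x_{i+1}=x_i,\ x_i=0 \text{ for } i\ll 0\},$$ an $F$-vector space in which $\pi^{-1}$ acts by $(x_i)\mapsto (x_{i+1})$, let $T_p(H)\subset V$ be the submodule of the sequences with $x_i=0$ for $i\le 0$, and put $v((x_i))=v(x_0)$ and $\mathrm{Fil}_\lambda V=\{x\in V\mid v(x)\ge\lambda\}$ for $\lambda\in\,]0,+\infty]$. The $\mathrm{Fil}_\lambda V$ are $\mathcal{O}$-lattices in $V$, and $\mathrm{Fil}_\infty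 V=T_p(H)$. Write $[\Lambda]$ for the homothety class of a lattice $\Lambda$, a vertex of the building $\mathcal{I}(V)$ of $\mathrm{PGL}(V)$, and for two vertices $x,y$ put $x\vee y=\{[\Lambda_1+\Lambda_2]\mid [\Lambda_1]=x,\ [\Lambda_2]=y\}$. There are real numbers $\varepsilon>0$ such that $v(x)\ge\varepsilon$ for all $x\in\pi^{-1}\mathrm{Fil}_\infty V$. For every such $\varepsilon$: 1. $S=\{[\mathrm{Fil}_\lambda V]\mid 0<\lambda\le\varepsilon\}$ is the set of vertices of a simplex of $\mathcal{I}(V)$, that is, $S=\{[\Lambda_0],\dots,[\Lambda_d]\}$ for lattices $\pi\Lambda_0\subsetneq\Lambda_d\subsetneq\cdots\subsetneq\Lambda_0$. 2. The set of vertices attached to the lower ramification filtration is determined by $S$ and the vertex $[T_p(H)]$: $$\{[\mathrm{Fil}_\lambda V]\mid \lambda\in\,]0,+\infty]\}=\bigcup_{x\in S}\bigl(x\vee[\mathrm{Fil}_\infty V]\bigr).$$ 3. This set is contained in the enclosure of $S\cup\{[T_p(H)]\}$: the set $S\cup\{[T_p(H)]\}$ is contained in an apartment $\{[\bigoplus_i\mathcal{O}\pi^{a_i}e_i]\mid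 a\in\mathbb{Z}^n\}$ for some basis $(e_1,\dots,e_n)$ of $V$, and for every such apartment, each $[\mathrm{Fil}_\lambda V]$ lies in that apartment and in all of its half-apartments $\{a_i-a_j+k\ge 0\}$ ($i\ne j$, $k\in\mathbb{Z}$) that contain $S\cup\{[T_p(H)]\}$. -/

import Mathlib

open scoped NormedField
open IsLocalRing

set_option linter.unusedSectionVars false

noncomputable section

namespace LubinTate

section Eval

variable {K : Type*} [NontriviallyNormedField K] [IsUltrametricDist K]

/-- The value `f(a)` of a power series with coefficients in the valuation ring of `K`. -/
def evalAt {σ : Type*} (f : MvPowerSeries σ (Valued.integer K)) (a : σ → Valued.integer K) :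
    Valued.integer K :=
  ∑' d : σ →₀ ℕ, MvPowerSeries.coeff d f * d.prod fun s e => a s ^ e

theorem isLinearTopology_integer : IsLinearTopology (Valued.integer K) (Valued.integer K) := by
  let I : ℝ → Ideal (Valued.integer K) := fun r =>
    { carrier := {x | ‖x‖ ≤ max r 0}
      add_mem' := fun {x y} hx hy =>
        (IsUltrametricDist.norm_add_le_max x y).trans (max_le hx hy)
      zero_mem' := by simp
      smul_mem' := fun c x hx => by
        rw [Set.mem_ofPred_eq, smul_eq_mul, norm_mul]
        exact (mul_le_of_le_one_left (norm_nonneg _) (Valued.integer.norm_le_one c)).trans hx }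
  refine IsLinearTopology.mk_of_hasBasis' (Valued.integer K) (p := fun r : ℝ => 0 < r) (s := I)
    (Metric.nhds_basis_closedBall.congr (fun _ => Iff.rfl) fun r hr => ?_)
    fun s r m hm => s.smul_mem r hm
  ext x
  change dist x 0 ≤ r ↔ ‖x‖ ≤ max r 0
  rw [max_eq_left hr.le, dist_zero_right]

theorem isClosed_integer : IsClosed ((Valued.integer K : Subring K) : Set K) := by
  have : ((Valued.integer K : Subring K) : Set K) = Metric.closedBall 0 1 := by
    ext x; simp [Valued.integer.mem_iff]
  rw [this]; exact Metric.isClosed_closedBall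

theorem completeSpace_integer [CompleteSpace K] : CompleteSpace (Valued.integer K) :=
  isClosed_integer.completeSpace_coe

theorem mem_maximalIdeal_iff {x : Valued.integer K} :
    x ∈ maximalIdeal (Valued.integer K) ↔ ‖x‖ < 1 := by
  rw [mem_maximalIdeal, mem_nonunits_iff, Valued.integer.isUnit_iff_norm_eq_one]
  exact ⟨fun h => lt_of_le_of_ne (Valued.integer.norm_le_one x) h, fun h => h.ne⟩

theorem hasEval_of_mem {σ : Type*} [Finite σ] {a : σ → Valued.integer K}
    (ha : ∀ s, a s ∈ maximalIdeal (Valued.integer K)) : MvPowerSeries.HasEval a where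
  hpow s := tendsto_pow_atTop_nhds_zero_of_norm_lt_one (mem_maximalIdeal_iff.1 (ha s))
  tendsto_zero := by simp [Filter.cofinite_eq_bot]

theorem norm_evalAt_le {σ : Type*} {f : MvPowerSeries σ (Valued.integer K)}
    (hf : MvPowerSeries.constantCoeff f = 0) {a : σ → Valued.integer K} {r : ℝ} (hr : 0 ≤ r)
    (ha : ∀ s, ‖a s‖ ≤ r) : ‖evalAt f a‖ ≤ r := by
  refine (IsUltrametricDist.norm_tsum_le _).trans (Real.iSup_le (fun d => ?_) hr)
  classical
  by_cases hd : d = 0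
  · subst hd
    rw [MvPowerSeries.coeff_zero_eq_constantCoeff_apply, hf, zero_mul, norm_zero]
    exact hr
  · obtain ⟨s, hs⟩ := Finsupp.ne_iff.1 hd
    have hs' : s ∈ d.support := by simpa using hs
    rw [Finsupp.prod, ← Finset.mul_prod_erase _ _ hs']
    obtain ⟨e, he⟩ := Nat.exists_eq_succ_of_ne_zero (Finsupp.mem_support_iff.1 hs')
    rw [he, pow_succ']
    rw [show ∀ u v w z : Valued.integer K, u * (v * w * z) = v * (u * w * z) by intros; ring,
      norm_mul]
    exact (mul_le_of_le_one_right (norm_nonneg _) (Valued.integer.norm_le_one _)).trans (ha s)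

theorem evalAt_mem {σ : Type*} [Finite σ] {f : MvPowerSeries σ (Valued.integer K)}
    (hf : MvPowerSeries.constantCoeff f = 0) {a : σ → Valued.integer K}
    (ha : ∀ s, a s ∈ maximalIdeal (Valued.integer K)) :
    evalAt f a ∈ maximalIdeal (Valued.integer K) := by
  rw [mem_maximalIdeal_iff]
  cases nonempty_fintype σ
  refine lt_of_le_of_lt (norm_evalAt_le hf (r := (Finset.univ.sup fun s => ‖a s‖₊ : NNReal))
    (NNReal.coe_nonneg _) fun s => ?_) ?_
  · exact_mod_cast Finset.le_sup (f := fun s => ‖a s‖₊) (Finset.mem_univ s)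
  · rw [← NNReal.coe_one, NNReal.coe_lt_coe, Finset.sup_lt_iff (by simp)]
    intro s _
    exact_mod_cast mem_maximalIdeal_iff.1 (ha s)

/-- Evaluation at `b` of the composite of formal power series, over an abstract coefficient ring. -/
theorem tsum_subst {R T σ τ : Type*} [CommRing R] [CommRing T] [UniformSpace T] [T2Space T]
    [CompleteSpace T] [IsUniformAddGroup T] [IsTopologicalRing T] [IsLinearTopology T T]
    [Algebra R T] {a : σ → MvPowerSeries τ R} (ha : MvPowerSeries.HasSubst a) {b : τ → T}
    (hb : MvPowerSeries.HasEval b)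
    (hab : MvPowerSeries.HasEval fun s => ∑' d : τ →₀ ℕ,
      algebraMap R T (MvPowerSeries.coeff d (a s)) * d.prod fun t e => b t ^ e)
    (f : MvPowerSeries σ R) :
    ∑' d : τ →₀ ℕ, algebraMap R T (MvPowerSeries.coeff d (MvPowerSeries.subst a f)) *
        d.prod (fun t e => b t ^ e) =
      ∑' d : σ →₀ ℕ, algebraMap R T (MvPowerSeries.coeff d f) *
        d.prod (fun s e => (∑' d : τ →₀ ℕ, algebraMap R T (MvPowerSeries.coeff d (a s)) *
          d.prod fun t e => b t ^ e) ^ e) := by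
  let _ : UniformSpace R := ⊥
  have _ : DiscreteUniformity R := ⟨rfl⟩
  have _ : DiscreteTopology R := inferInstance
  have hc : Continuous (algebraMap R T) := continuous_of_discreteTopology
  have hE := fun g : MvPowerSeries τ R => MvPowerSeries.eval₂_eq_tsum hc hb g
  rw [← hE, MvPowerSeries.eval₂_subst ha hb]
  simp only [hE] 
  exact MvPowerSeries.eval₂_eq_tsum hc hab f

theorem evalAt_subst [CompleteSpace K] {σ τ : Type*} [Finite σ] [Finite τ]
    {a : σ → MvPowerSeries τ (Valued.integer K)}
    (ha : ∀ s, MvPowerSeries.constantCoeff (a s) = 0) {b : τ → Valued.integer K}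
    (hb : ∀ t, b t ∈ maximalIdeal (Valued.integer K)) (f : MvPowerSeries σ (Valued.integer K)) :
    evalAt (MvPowerSeries.subst a f) b = evalAt f fun s => evalAt (a s) b := by
  have _ := completeSpace_integer (K := K)
  have _ := isLinearTopology_integer (K := K)
  exact tsum_subst (R := Valued.integer K) (T := Valued.integer K)
    (MvPowerSeries.hasSubst_of_constantCoeff_zero ha) (hasEval_of_mem hb)
    (hasEval_of_mem fun s => evalAt_mem (ha s) hb) f

theorem evalAt_X {σ : Type*} (s : σ) (a : σ → Valued.integer K) :
    evalAt (MvPowerSeries.X s) a = a s := by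
  classical
  unfold evalAt
  rw [tsum_eq_single (Finsupp.single s 1)]
  · simp
  · intro d hd
    rw [MvPowerSeries.coeff_X, if_neg hd, zero_mul]

theorem evalAt_zero {σ : Type*} (a : σ → Valued.integer K) : evalAt 0 a = 0 := by
  simp [evalAt]

end Eval

/-- A one-dimensional formal `O`-module over an `O`-algebra `R`: a commutative one-dimensional
formal group law together with a ring homomorphism `a ↦ [a](T)` from `O` to its endomorphisms such
that `[a](T) = a T + ⋯`. -/
structure FormalModule (O R : Type*) [CommRing O] [CommRing R] [Algebra O R]
    extends FormalGroup R where
  comm : toFormalGroup.IsComm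
  act : O → PowerSeries R
  constantCoeff_act : ∀ a, PowerSeries.constantCoeff (act a) = 0
  coeff_one_act : ∀ a, PowerSeries.coeff 1 (act a) = algebraMap O R a
  act_hom : ∀ a, (act a).subst toPowerSeries =
    toPowerSeries.subst ![(act a).subst (MvPowerSeries.X 0 : MvPowerSeries (Fin 2) R),
      (act a).subst (MvPowerSeries.X 1 : MvPowerSeries (Fin 2) R)]
  act_zero : act 0 = 0
  act_one : act 1 = PowerSeries.X
  act_add : ∀ a b, act (a + b) = toPowerSeries.subst ![act a, act b]
  act_mul : ∀ a b, act (a * b) = (act a).subst (act b)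


section Points

variable {F K : Type*} [NontriviallyNormedField F] [IsUltrametricDist F]
  [NontriviallyNormedField K] [IsUltrametricDist K] [NormedAlgebra F K]

/-- The inclusion of the valuation ring of `F` into that of the valued extension `K`. -/
instance algebraInteger : Algebra (Valued.integer F) (Valued.integer K) :=
  ((algebraMap F K).restrict (Valued.integer F) (Valued.integer K) fun x hx => by
    rw [Valued.integer.mem_iff] at hx ⊢
    rwa [norm_algebraMap']).toAlgebra

variable (H : FormalModule (Valued.integer F) (Valued.integer K))

/-- The points of the formal group with values in the valuation ring of `K`: via the coordinate of
the formal group law, these are the elements of positive valuation. -/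
def Points (_H : FormalModule (Valued.integer F) (Valued.integer K)) : Type _ :=
  maximalIdeal (Valued.integer K)

variable {H}

/-- The coordinate of a point. -/
def Points.coord (x : Points H) : Valued.integer K := x.1

@[ext] theorem Points.ext {x y : Points H} (h : x.coord = y.coord) : x = y := Subtype.ext h

theorem Points.coord_mem (x : Points H) : x.coord ∈ maximalIdeal (Valued.integer K) := x.2

instance : Zero (Points H) := ⟨⟨0, zero_mem _⟩⟩

instance : Add (Points H) :=
  ⟨fun x y => ⟨evalAt H.toPowerSeries ![x.coord, y.coord],
    evalAt_mem H.zero_constantCoeff (by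
      intro s; fin_cases s
      · exact x.coord_mem
      · exact y.coord_mem)⟩⟩

instance : SMul (Valued.integer F) (Points H) :=
  ⟨fun a x => ⟨evalAt (H.act a) fun _ => x.coord,
    evalAt_mem (H.constantCoeff_act a) fun _ => x.coord_mem⟩⟩

theorem Points.coord_zero : (0 : Points H).coord = 0 := rfl

theorem Points.coord_add (x y : Points H) :
    (x + y).coord = evalAt H.toPowerSeries ![x.coord, y.coord] := rfl

theorem Points.coord_smul (a : Valued.integer F) (x : Points H) :
    (a • x).coord = evalAt (H.act a) fun _ => x.coord := rfl

variable [CompleteSpace K]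

theorem Points.coord_subst_add {τ : Type*} [Finite τ]
    {f g : MvPowerSeries τ (Valued.integer K)}
    (hf : MvPowerSeries.constantCoeff f = 0) (hg : MvPowerSeries.constantCoeff g = 0)
    {b : τ → Valued.integer K} (hb : ∀ t, b t ∈ maximalIdeal (Valued.integer K)) :
    evalAt (MvPowerSeries.subst ![f, g] H.toPowerSeries) b =
      evalAt H.toPowerSeries ![evalAt f b, evalAt g b] := by
  rw [evalAt_subst (by intro s; fin_cases s <;> assumption) hb]
  congr 1
  ext s; fin_cases s <;> rfl

theorem Points.coord_subst_act {τ : Type*} [Finite τ] {a : Valued.integer F}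
    {f : MvPowerSeries τ (Valued.integer K)} (hf : MvPowerSeries.constantCoeff f = 0)
    {b : τ → Valued.integer K} (hb : ∀ t, b t ∈ maximalIdeal (Valued.integer K)) :
    evalAt (PowerSeries.subst f (H.act a)) b = evalAt (H.act a) fun _ => evalAt f b :=
  evalAt_subst (fun _ => hf) hb _

theorem Points.zero_add' (x : Points H) : 0 + x = x := by
  ext1
  have h := congrArg (fun f => evalAt f fun _ => x.coord) H.toFormalGroup.zeroX_eq_X
  simp only [FormalGroup.zeroX] at h
  rw [coord_subst_add (map_zero _) PowerSeries.constantCoeff_X fun _ => x.coord_mem,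
    evalAt_zero] at h
  rw [coord_add, coord_zero]
  refine Eq.trans ?_ (h.trans (evalAt_X () _))
  rw [PowerSeries.X, evalAt_X]

theorem Points.add_comm' (x y : Points H) : x + y = y + x := by
  ext1
  have hb : ∀ t, ![x.coord, y.coord] t ∈ maximalIdeal (Valued.integer K) := by
    intro s; fin_cases s
    · exact x.coord_mem
    · exact y.coord_mem
  have h := congrArg (fun f => evalAt f ![x.coord, y.coord])
    H.comm.comm
  beta_reduce at h
  rw [coord_subst_add (MvPowerSeries.constantCoeff_X 1) (MvPowerSeries.constantCoeff_X 0) hb,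
    evalAt_X, evalAt_X] at h
  exact h

theorem Points.add_assoc' (x y z : Points H) : x + y + z = x + (y + z) := by
  ext1
  have hb : ∀ t, ![x.coord, y.coord, z.coord] t ∈ maximalIdeal (Valued.integer K) := by
    intro s; fin_cases s
    · exact x.coord_mem
    · exact y.coord_mem
    · exact z.coord_mem
  have h := congrArg (fun f => evalAt f ![x.coord, y.coord, z.coord]) H.assoc
  have hX : ∀ i : Fin 3, MvPowerSeries.constantCoeff
    (MvPowerSeries.X i : MvPowerSeries (Fin 3) (Valued.integer K)) = 0 := fun i =>
      MvPowerSeries.constantCoeff_X i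
  have hF : ∀ i j : Fin 3, MvPowerSeries.constantCoeff (MvPowerSeries.subst
    ![(MvPowerSeries.X i : MvPowerSeries (Fin 3) (Valued.integer K)), MvPowerSeries.X j]
      H.toPowerSeries) = 0 := fun i j =>
    MvPowerSeries.constantCoeff_subst_eq_zero .X_X
      (by intro s; fin_cases s <;> exact hX _) H.zero_constantCoeff
  beta_reduce at h
  rw [coord_subst_add (hF _ _) (hX _) hb, coord_subst_add (hX _) (hF _ _) hb,
    coord_subst_add (hX _) (hX _) hb, coord_subst_add (hX _) (hX _) hb] at h
  simp only [evalAt_X] at h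
  exact h

theorem Points.act_add' (a b : Valued.integer F) (x : Points H) :
    (a + b) • x = a • x + b • x := by
  ext1
  rw [coord_smul, H.act_add, coord_subst_add (H.constantCoeff_act a) (H.constantCoeff_act b)
    fun _ => x.coord_mem]
  rfl

theorem Points.act_zero' (x : Points H) : (0 : Valued.integer F) • x = 0 := by
  ext1
  rw [coord_smul, H.act_zero, evalAt_zero, coord_zero]

theorem Points.act_one' (x : Points H) : (1 : Valued.integer F) • x = x := by
  ext1
  rw [coord_smul, H.act_one, PowerSeries.X, evalAt_X]

theorem Points.act_mul' (a b : Valued.integer F) (x : Points H) : (a * b) • x = a • b • x := by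
  ext1
  rw [coord_smul, H.act_mul, coord_subst_act (H.constantCoeff_act b) fun _ => x.coord_mem]
  rfl

theorem Points.act_hom' (a : Valued.integer F) (x y : Points H) :
    a • (x + y) = a • x + a • y := by
  ext1
  have hb : ∀ t, ![x.coord, y.coord] t ∈ maximalIdeal (Valued.integer K) := by
    intro s; fin_cases s
    · exact x.coord_mem
    · exact y.coord_mem
  have hX : ∀ i : Fin 2, MvPowerSeries.constantCoeff
    (MvPowerSeries.X i : MvPowerSeries (Fin 2) (Valued.integer K)) = 0 := fun i =>
      MvPowerSeries.constantCoeff_X i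
  have hA : ∀ i : Fin 2, MvPowerSeries.constantCoeff (PowerSeries.subst
    (MvPowerSeries.X i : MvPowerSeries (Fin 2) (Valued.integer K)) (H.act a)) = 0 := fun i =>
    PowerSeries.constantCoeff_subst_eq_zero (hX i) _ (H.constantCoeff_act a)
  have h := congrArg (fun f => evalAt f ![x.coord, y.coord]) (H.act_hom a)
  beta_reduce at h
  rw [coord_subst_act H.zero_constantCoeff hb, coord_subst_add (hA 0) (hA 1) hb,
    coord_subst_act (hX 0) hb, coord_subst_act (hX 1) hb, evalAt_X, evalAt_X] at h
  exact h

instance : Neg (Points H) := ⟨fun x => (-1 : Valued.integer F) • x⟩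

instance : AddCommGroup (Points H) where
  add_assoc := Points.add_assoc'
  zero_add := Points.zero_add'
  add_zero x := by rw [Points.add_comm', Points.zero_add']
  add_comm := Points.add_comm'
  neg_add_cancel x := by
    change (-1 : Valued.integer F) • x + x = 0
    nth_rw 2 [← Points.act_one' x]
    rw [← Points.act_add', neg_add_cancel, Points.act_zero']
  nsmul := nsmulRec
  zsmul := zsmulRec

instance : Module (Valued.integer F) (Points H) where
  one_smul := Points.act_one'
  mul_smul := Points.act_mul'
  smul_zero a := by
    have h := Points.act_hom' a (0 : Points H) 0
    rwa [Points.zero_add', left_eq_add] at h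
  smul_add := Points.act_hom'
  add_smul := Points.act_add'
  zero_smul := Points.act_zero'

/-! ### The rational Tate module -/

/-- A uniformizer of `F`. -/
abbrev Uniformizer (F : Type*) [NontriviallyNormedField F] [IsUltrametricDist F] : Type _ :=
  {ϖ : Valued.integer F // Irreducible ϖ}

variable (H) in
/-- The rational Tate module `V_p(H)`: sequences `(x_i)`, indexed by the integers, of points with
`π x_{i+1} = x_i` for all `i` and `x_i = 0` for `i` very negative. -/
def tateV (π : Uniformizer F) : Submodule (Valued.integer F) (ℤ → Points H) where
  carrier := {x | (∀ i, π.1 • x (i + 1) = x i) ∧ ∃ N : ℤ, ∀ i ≤ N, x i = 0}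
  add_mem' := by
    rintro x y ⟨hx, M, hM⟩ ⟨hy, N, hN⟩
    refine ⟨fun i => ?_, min M N, fun i hi => ?_⟩
    · rw [Pi.add_apply, Pi.add_apply, smul_add, hx, hy]
    simp [hM i (hi.trans (min_le_left _ _)), hN i (hi.trans (min_le_right _ _))]
  zero_mem' := ⟨fun _ => smul_zero _, 0, fun i _ => rfl⟩
  smul_mem' := by
    rintro c x ⟨hx, M, hM⟩
    refine ⟨fun i => ?_, M, fun i hi => by rw [Pi.smul_apply, hM i hi, smul_zero]⟩
    rw [Pi.smul_apply, Pi.smul_apply, smul_comm, hx]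

variable {π : Uniformizer F}

theorem tateV_pow_smul (x : tateV H π) (m : ℕ) (i : ℤ) :
    π.1 ^ m • x.1 (i + m) = x.1 i := by
  induction m generalizing i with
  | zero => simp
  | succ m ih =>
    rw [pow_succ, mul_smul, Nat.cast_succ, ← add_assoc, x.2.1, ih]

theorem exists_clear (π : Uniformizer F) (a : F) :
    ∃ (k : ℕ) (b : Valued.integer F), (b : F) = (π.1 : F) ^ k * a := by
  have h1 : ‖(π.1 : F)‖ < 1 := Valued.integer.norm_irreducible_lt_one π.2
  have h2 : Filter.Tendsto (fun k : ℕ => ‖(π.1 : F) ^ k * a‖) Filter.atTop (nhds 0) := by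
    simpa using ((tendsto_pow_atTop_nhds_zero_of_norm_lt_one h1).mul_const a).norm
  obtain ⟨k, hk⟩ := (h2.eventually (gt_mem_nhds one_pos)).exists
  exact ⟨k, ⟨_, Valued.integer.mem_iff.2 hk.le⟩, rfl⟩

/-- An exponent `k` such that `π ^ k a` is integral. -/
def clearExp (π : Uniformizer F) (a : F) : ℕ := (exists_clear π a).choose

/-- The integral element `π ^ k a`. -/
def clearNum (π : Uniformizer F) (a : F) : Valued.integer F := (exists_clear π a).choose_spec.choose

theorem coe_clearNum (π : Uniformizer F) (a : F) :
    (clearNum π a : F) = (π.1 : F) ^ clearExp π a * a :=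
  (exists_clear π a).choose_spec.choose_spec

/-- `F` acts on `V_p(H)`: multiplication by `π⁻¹` is the shift `(x_i) ↦ (x_{i+1})`, so that `a` acts
by `x ↦ (b x_{i+k})` where `b = π ^ k a` is integral; this does not depend on `k`, see
`tateV_smul_apply`. -/
instance : SMul F (tateV H π) where
  smul a x := ⟨fun i => clearNum π a • x.1 (i + clearExp π a), by
    refine ⟨fun i => ?_, ?_⟩
    · rw [smul_comm, show i + 1 + (clearExp π a : ℤ) = i + clearExp π a + 1 by ring, x.2.1]
    · obtain ⟨N, hN⟩ := x.2.2
      exact ⟨N - clearExp π a, fun i hi => by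
        change clearNum π a • x.1 (i + clearExp π a) = 0
        rw [hN _ (by omega), smul_zero]⟩⟩

theorem tateV_smul_apply (a : F) (x : tateV H π) (k : ℕ) (b : Valued.integer F)
    (hb : (b : F) = (π.1 : F) ^ k * a) (i : ℤ) : (a • x).1 i = b • x.1 (i + k) := by
  change clearNum π a • x.1 (i + clearExp π a) = _
  rw [← tateV_pow_smul x k (i + clearExp π a), ← tateV_pow_smul x (clearExp π a) (i + k),
    smul_smul, smul_smul, show i + (k : ℤ) + clearExp π a = i + clearExp π a + k by ring]
  congr 1
  apply Subtype.ext
  push_cast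
  rw [hb, coe_clearNum]
  ring

instance : Module F (tateV H π) where
  one_smul x := Subtype.ext <| funext fun i => by
    rw [tateV_smul_apply 1 x 0 1 (by simp)]; simp
  mul_smul a b x := Subtype.ext <| funext fun i => by
    rw [tateV_smul_apply (a * b) x (clearExp π a + clearExp π b) (clearNum π a * clearNum π b)
      (by push_cast; rw [coe_clearNum, coe_clearNum]; ring),
      tateV_smul_apply a _ _ _ (coe_clearNum π a), tateV_smul_apply b _ _ _ (coe_clearNum π b),
      mul_smul, Nat.cast_add, add_assoc]
  smul_zero a := Subtype.ext <| funext fun i => smul_zero (clearNum π a)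
  zero_smul x := Subtype.ext <| funext fun i => by
    rw [tateV_smul_apply 0 x 0 0 (by simp)]; simp
  smul_add a x y := Subtype.ext <| funext fun i => smul_add (clearNum π a) _ _
  add_smul a b x := Subtype.ext <| funext fun i => by
    have ha : ((π.1 ^ clearExp π b * clearNum π a : Valued.integer F) : F) =
        (π.1 : F) ^ (clearExp π a + clearExp π b) * a := by
      push_cast; rw [coe_clearNum]; ring
    have hb : ((π.1 ^ clearExp π a * clearNum π b : Valued.integer F) : F) =
        (π.1 : F) ^ (clearExp π a + clearExp π b) * b := by
      push_cast; rw [coe_clearNum]; ring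
    change _ = (a • x).1 i + (b • x).1 i
    rw [tateV_smul_apply (a + b) x (clearExp π a + clearExp π b)
      (π.1 ^ clearExp π b * clearNum π a + π.1 ^ clearExp π a * clearNum π b)
      (by rw [mul_add, ← ha, ← hb]; rfl),
      tateV_smul_apply a x _ _ ha, tateV_smul_apply b x _ _ hb, add_smul]

instance : IsScalarTower (Valued.integer F) F (tateV H π) where
  smul_assoc c a x := Subtype.ext <| funext fun i => by
    change _ = c • (a • x).1 i
    rw [tateV_smul_apply (c • a) x (clearExp π a) (c * clearNum π a)
      (by push_cast; rw [coe_clearNum, Subring.smul_def, smul_eq_mul]; ring),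
      tateV_smul_apply a x _ _ (coe_clearNum π a), mul_smul]

variable (H π) in
/-- The Tate module `T_p(H)`, the sequences in `V_p(H)` with `x_i = 0` for `i ≤ 0`. -/
def tateT : Submodule (Valued.integer F) (tateV H π) where
  carrier := {x | ∀ i ≤ 0, x.1 i = 0}
  add_mem' := fun {x y} hx hy i hi => by
    change x.1 i + y.1 i = 0
    rw [hx i hi, hy i hi, add_zero]
  zero_mem' := fun i _ => rfl
  smul_mem' := fun c x hx i hi => by
    change c • x.1 i = 0
    rw [hx i hi, smul_zero]

/-! ### The valuation and the lower ramification filtration -/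

/-- The additive valuation of `K` normalized by `v(π) = 1`. -/
def val (π : Uniformizer F) (z : Valued.integer K) : EReal :=
  open Classical in
  if z = 0 then ⊤ else ((Real.log ‖z‖ / Real.log ‖π.1‖ : ℝ) : EReal)

/-- The valuation of an element `(x_i)` of `V_p(H)` is that of the point `x_0`. -/
def vV (x : tateV H π) : EReal := val π (x.1 0).coord

theorem val_anti (π : Uniformizer F) {z w : Valued.integer K} (h : ‖z‖ ≤ ‖w‖) :
    val π w ≤ val π z := by
  unfold val
  split_ifs with hw hz hz
  · exact le_rfl
  · rw [hw, norm_zero] at h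
    exact absurd (norm_le_zero_iff.1 h) hz
  · exact le_top
  · have h0 : 0 < ‖π.1‖ := Valued.integer.norm_irreducible_pos π.2
    have h1 : ‖π.1‖ < 1 := Valued.integer.norm_irreducible_lt_one π.2
    exact EReal.coe_le_coe_iff.2 (div_le_div_of_nonpos_of_le (Real.log_neg h0 h1).le
      (Real.log_le_log (norm_pos_iff.2 hz) h))

theorem min_val_le_val_add (π : Uniformizer F) (x y : Points H) :
    min (val π x.coord) (val π y.coord) ≤ val π (x + y).coord := by
  have h : ‖(x + y).coord‖ ≤ max ‖x.coord‖ ‖y.coord‖ := by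
    refine norm_evalAt_le H.zero_constantCoeff (le_max_of_le_left (norm_nonneg _)) fun s => ?_
    fin_cases s
    · exact le_max_left _ _
    · exact le_max_right _ _
  rcases le_max_iff.1 h with h | h
  · exact (min_le_left _ _).trans (val_anti π h)
  · exact (min_le_right _ _).trans (val_anti π h)

theorem val_le_val_smul (π : Uniformizer F) (a : Valued.integer F) (x : Points H) :
    val π x.coord ≤ val π (a • x).coord :=
  val_anti π (norm_evalAt_le (H.constantCoeff_act a) (norm_nonneg _) fun _ => le_rfl)

variable (H π) in
/-- The lower ramification filtration `Fil_t V = {x ∈ V | v(x) ≥ t}`. -/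
def fil (t : EReal) : Submodule (Valued.integer F) (tateV H π) where
  carrier := {x | t ≤ vV x}
  add_mem' := fun {x y} hx hy => (le_min hx hy).trans (min_val_le_val_add π (x.1 0) (y.1 0))
  zero_mem' := by
    change t ≤ val π (0 : Points H).coord
    rw [Points.coord_zero, val, if_pos rfl]
    exact le_top
  smul_mem' := fun c x hx => le_trans hx (val_le_val_smul π c (x.1 0))

end Points

/-! ### The vertices of the building of `PGL(V)` -/

section Building

open scoped Pointwise

variable {O F V : Type*} [CommRing O] [Field F] [Algebra O F] [AddCommGroup V] [Module O V]
  [Module F V] [IsScalarTower O F V]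

variable (O F V) in
/-- Homothety classes of `O`-submodules of `V`, under the action of `Fˣ`. -/
abbrev HomothetyClass : Type _ := MulAction.orbitRel.Quotient Fˣ (Submodule O V)

variable (F) in
/-- The homothety class `[Λ]`. -/
def cls (L : Submodule O V) : HomothetyClass O F V := Quotient.mk _ L

/-- The sets of vertices of the simplices of the building: the sets `{[Λ_0], …, [Λ_d]}` where the
`Λ_i` are lattices such that `π Λ_0 ⊊ Λ_d ⊊ ⋯ ⊊ Λ_0`. -/
def IsSimplex (ϖ : O) (s : Set (HomothetyClass O F V)) : Prop :=
  ∃ (d : ℕ) (L : Fin (d + 1) → Submodule O V), (∀ i, (L i).IsLattice F) ∧ StrictAnti L ∧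
    ϖ • L 0 < L (Fin.last d) ∧ s = Set.range fun i => cls F (L i)

/-- `x ∨ y = {[Λ₁ + Λ₂] | [Λ₁] = x, [Λ₂] = y}`. -/
def vee (x y : HomothetyClass O F V) : Set (HomothetyClass O F V) :=
  {z | ∃ L₁ L₂ : Submodule O V, cls F L₁ = x ∧ cls F L₂ = y ∧ z = cls F (L₁ ⊔ L₂)}

variable {ι : Type*}

/-- The lattice spanned over `O` by the `π ^ (a i) e_i`. -/
def diagLattice (ϖ : O) (e : Module.Basis ι F V) (a : ι → ℤ) : Submodule O V :=
  Submodule.span O (Set.range fun i => (algebraMap O F ϖ) ^ a i • e i)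

/-- The vertices of the apartment attached to a basis of `V`. -/
def apartment (ϖ : O) (e : Module.Basis ι F V) : Set (HomothetyClass O F V) :=
  Set.range fun a : ι → ℤ => cls F (diagLattice ϖ e a)

/-- The vertices of the half-apartment `α_{ij} + k ≥ 0`, where `α_{ij} = a_i - a_j`. -/
def halfApartment (ϖ : O) (e : Module.Basis ι F V) (i j : ι) (k : ℤ) :
    Set (HomothetyClass O F V) :=
  {x | ∃ a : ι → ℤ, x = cls F (diagLattice ϖ e a) ∧ 0 ≤ a i - a j + k}

/-- The vertices of the enclosure of `M` in an apartment containing `M`: the intersection of the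
half-apartments of this apartment that contain `M`. -/
def enclos (ϖ : O) (e : Module.Basis ι F V) (M : Set (HomothetyClass O F V)) :
    Set (HomothetyClass O F V) :=
  {x ∈ apartment ϖ e | ∀ (i j : ι) (k : ℤ), i ≠ j → M ⊆ halfApartment ϖ e i j k →
    x ∈ halfApartment ϖ e i j k}

end Building

section Ramification

variable {F K : Type*} [NontriviallyNormedField F] [IsUltrametricDist F]
  [NontriviallyNormedField K] [IsUltrametricDist K] [NormedAlgebra F K]
  (H : FormalModule (Valued.integer F) (Valued.integer K)) (π : Uniformizer F)

/-- `H` has `O`-height `n`: the reduction of `[π](T)` modulo the maximal ideal has order `q ^ n`,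
where `q` is the cardinality of the residue field of `F`. -/
def HasHeight (n : ℕ) : Prop :=
  (PowerSeries.map (residue (Valued.integer K)) (H.act π.1)).order =
    ((Nat.card (ResidueField (Valued.integer F)) ^ n : ℕ) : ℕ∞)

variable [CompleteSpace K]

/-- The vertices of the building attached to the lower ramification filtration. -/
def ramificationVertices : Set (HomothetyClass (Valued.integer F) F (tateV H π)) :=
  {x | ∃ t : EReal, 0 < t ∧ x = cls F (fil H π t)}

/-- `ε` is at most the valuation of every element of `π⁻¹ Fil_∞ V`. -/
def IsSmall (ε : ℝ) : Prop :=
  ∀ x : tateV H π, π.1 • x ∈ fil H π ⊤ → (ε : EReal) ≤ vV x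

/-- The set of vertices `{[Fil_t V] | 0 < t ≤ ε}`. -/
def smallVertices (ε : ℝ) : Set (HomothetyClass (Valued.integer F) F (tateV H π)) :=
  {x | ∃ t : ℝ, 0 < t ∧ t ≤ ε ∧ x = cls F (fil H π t)}

end Ramification

end LubinTate

end

/-!
Replace valuations by absolute values: for `0 ≤ r < 1` let `V_r` be the set of `x ∈ V` with
`|x₀| ≤ r` (`normFil`), so that `V_0 = T` is the Tate module. Everything follows from how
multiplication by `π` moves these submodules.

By Weierstrass preparation over the algebraically closed field `K`, the size of a power series on
the open unit disc is the product of the distances to its roots (`exists_roots`). Applied to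
`[π](T)`, this says that `[π]` is surjective on points, that its kernel `Z` has `Q = q ^ n` elements
and that `|[π] x| = ∏ |x - z|` over `z ∈ Z` (`exists_isKernel`). After translation of `x` by the
element of `Z` nearest to it, the right-hand side is `φ |x|` with `φ r = ∏ max |z| r` (`renumber`).
Hence `π V_r + T = V_{φ r}` for all `r` (`unif_smul_normFil_sup`). If all `z ∈ Z` have size at most
`δ`, then `φ r = r ^ Q` and `T ⊆ π V_r` for `r ≥ δ`, so that `π V_r = V_{r ^ Q}`
(`unif_smul_normFil`). The hypothesis on `ε` says precisely that `δ = |π| ^ ε` has this property.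

* The module `T` is `π`-adically separated and `T / π T = Z`, hence it is free of rank `n`
  (`finite_tateT`, `finrank_tateT`). Each `V_r` lies between `T` and some `π ^ (-m) T`, because the
  torsion points of size at most `r` are killed by a common power of `π`; so `V_r` is a lattice.
* The homothety classes of the `V_r` with `r ≥ δ` are those with `r` in a fundamental domain
  `[δ', η[`, `η ^ Q = δ'`, of the map `r ↦ r ^ Q`. Only finitely many sizes of torsion points lie in
  that interval, and the corresponding `V_r` form the chain that defines the simplex (`isSimplex`).
* The function `φ` is continuous and its iterates carry `[δ, 1[` to all of `]0, 1[`, so each `V_r`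
  with `r > 0` is `π ^ k V_s + T` for some `s ≥ δ`. This is the description of the vertices by
  means of the operation `∨` (`iUnion_vee_eq`).
* The sizes `|x_k|` for large `k` compare the elements of `T` in the way a norm does. A basis of `T`
  orthogonal for this comparison (`exists_basis_forall_rel`) diagonalizes `T` and all `V_r` with
  `r ≥ δ` at once, which gives an apartment (`exists_basis_diagLattice`).
* In any apartment that contains the classes of two lattices, the sum of the lattices is diagonal
  and its exponents are the minima of theirs, so its class lies in the enclosure of the two
  (`cls_sup_mem_enclos`). The description by means of `∨` concludes.
-/

noncomputable section

open scoped NNReal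

namespace LubinTate

/-! ### Valuation rings of complete ultrametric fields -/

section Integers

variable {K : Type*} [NontriviallyNormedField K] [IsUltrametricDist K]

theorem dvd_iff_norm_le {x y : Valued.integer K} : x ∣ y ↔ ‖y‖ ≤ ‖x‖ := by
  constructor
  · rintro ⟨c, rfl⟩
    rw [norm_mul]
    exact mul_le_of_le_one_right (norm_nonneg _) (Valued.integer.norm_le_one c)
  · intro h
    by_cases hx : x = 0
    · rw [hx, norm_zero] at h
      rw [norm_le_zero_iff.1 h]
      exact dvd_zero _
    · have hx' : (x : K) ≠ 0 := fun h0 => hx (Subtype.ext h0)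
      refine ⟨⟨y / x, Valued.integer.mem_iff.2 ?_⟩, Subtype.ext ?_⟩
      · rw [norm_div]
        exact div_le_one_of_le₀ h (norm_nonneg _)
      · change (y : K) = x * (y / x)
        field_simp

theorem mem_span_pow_iff {c x : Valued.integer K} {k : ℕ} :
    x ∈ Ideal.span {c} ^ k ↔ ‖x‖ ≤ ‖c‖ ^ k := by
  rw [Ideal.span_singleton_pow, Ideal.mem_span_singleton, dvd_iff_norm_le, norm_pow]

/-- The valuation ring of a complete field need not be complete for its maximal ideal, which may be
idempotent, but it is complete for every proper principal ideal. -/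
theorem isAdicComplete_span [CompleteSpace K] {c : Valued.integer K} (hc : ‖c‖ < 1) :
    IsAdicComplete (Ideal.span {c}) (Valued.integer K) where
  haus' x hx := by
    have h : ∀ k, ‖x‖ ≤ ‖c‖ ^ k := fun k => by
      have := hx k
      rw [SModEq.zero, smul_eq_mul, Ideal.mul_top] at this
      exact mem_span_pow_iff.1 this
    exact norm_le_zero_iff.1
      (ge_of_tendsto' (tendsto_pow_atTop_nhds_zero_of_lt_one (norm_nonneg _) hc) h)
  prec' f hf := by
    have _ := completeSpace_integer (K := K)
    have h : ∀ {m n}, m ≤ n → dist (f m) (f n) ≤ ‖c‖ ^ m := fun {m n} hmn => by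
      have := hf hmn
      rw [SModEq.sub_mem, smul_eq_mul, Ideal.mul_top] at this
      rw [dist_eq_norm]
      exact mem_span_pow_iff.1 this
    obtain ⟨L, hL⟩ := cauchySeq_tendsto_of_complete (cauchySeq_of_le_tendsto_0 (fun m => ‖c‖ ^ m)
      (fun n m N hn hm => by
        refine (IsUltrametricDist.dist_triangle_max (f n) (f N) (f m)).trans (max_le ?_ (h hm))
        rw [dist_comm]
        exact h hn) (tendsto_pow_atTop_nhds_zero_of_lt_one (norm_nonneg _) hc))
    refine ⟨L, fun n => ?_⟩
    rw [SModEq.sub_mem, smul_eq_mul, Ideal.mul_top, mem_span_pow_iff, ← dist_eq_norm]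
    refine le_of_tendsto (tendsto_const_nhds.dist hL) ?_
    filter_upwards [Filter.eventually_ge_atTop n] with m hm using h hm

end Integers

section LocalField

theorem isDiscreteValuationRing_and_completeSpace (p : ℕ) [Fact p.Prime] (F : Type*)
    [NontriviallyNormedField F] [IsUltrametricDist F] [NormedAlgebra ℚ_[p] F]
    [FiniteDimensional ℚ_[p] F] :
    IsDiscreteValuationRing (Valued.integer F) ∧ CompleteSpace F := by
  have hF : ProperSpace F := FiniteDimensional.proper ℚ_[p] F
  have hc : CompactSpace (Valued.integer F) := by
    have h : IsCompact ((Valued.integer F : Subring F) : Set F) := by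
      convert isCompact_closedBall (0 : F) 1
      ext x; simp [Valued.integer.mem_iff]
    exact isCompact_iff_compactSpace.1 h
  let _ : (Valued.v : Valuation F _).RankOne :=
    inferInstanceAs (NormedField.valuation (K := F)).RankOne
  have h := (open Valued.integer in
    compactSpace_iff_completeSpace_and_isDiscreteValuationRing_and_finite_residueField.1 hc)
  exact ⟨h.2.1, inferInstance⟩

end LocalField

/-! ### Values of power series -/

section Eval

variable {K : Type*} [NontriviallyNormedField K] [IsUltrametricDist K] [CompleteSpace K]

/-- At a point of the open unit polydisc, the series that defines the value of a power series
converges, and evaluation is a ring homomorphism. -/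
theorem exists_ringHom_hasSum_evalAt {σ : Type*} [Finite σ] {a : σ → Valued.integer K}
    (ha : ∀ s, a s ∈ maximalIdeal (Valued.integer K)) :
    ∃ φ : MvPowerSeries σ (Valued.integer K) →+* Valued.integer K, (∀ f, φ f = evalAt f a) ∧
      ∀ f, HasSum (fun d => MvPowerSeries.coeff d f * d.prod fun s e => a s ^ e) (evalAt f a) := by
  have _ := completeSpace_integer (K := K)
  have _ := isLinearTopology_integer (K := K)
  -- The coefficient ring `R` gets the discrete topology, so it is kept apart from the target `T`.
  have key : ∀ {R T : Type _} [CommRing R] [CommRing T] [UniformSpace T] [T2Space T]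
      [CompleteSpace T] [IsUniformAddGroup T] [IsTopologicalRing T] [IsLinearTopology T T]
      [Algebra R T] {b : σ → T} (_ : MvPowerSeries.HasEval b),
      ∃ φ : MvPowerSeries σ R →+* T, ∀ f,
        HasSum (fun d => algebraMap R T (MvPowerSeries.coeff d f) *
          d.prod fun s e => b s ^ e) (φ f) := by
    intro R T _ _ _ _ _ _ _ _ _ b hb
    let _ : UniformSpace R := ⊥
    have _ : DiscreteUniformity R := ⟨rfl⟩
    have _ : DiscreteTopology R := inferInstance
    have hc : Continuous (algebraMap R T) := continuous_of_discreteTopology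
    exact ⟨MvPowerSeries.eval₂Hom hc hb, fun f => by
      rw [MvPowerSeries.coe_eval₂Hom]
      exact MvPowerSeries.hasSum_eval₂ hc hb f⟩
  obtain ⟨φ, hφ⟩ := key (R := Valued.integer K) (T := Valued.integer K) (hasEval_of_mem ha)
  have h : ∀ f, φ f = evalAt f a := fun f => (hφ f).tsum_eq.symm
  exact ⟨φ, h, fun f => h f ▸ hφ f⟩

end Eval

/-! ### Roots of power series in the open unit disc -/

section Roots

variable {K : Type*} [NontriviallyNormedField K] [IsUltrametricDist K]

theorem exists_span_singleton_of_forall_mem_maximalIdeal {Q : ℕ} {f : ℕ → Valued.integer K}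
    (hf : ∀ i < Q, f i ∈ maximalIdeal (Valued.integer K)) :
    ∃ c : Valued.integer K, ‖c‖ < 1 ∧ ∀ i < Q, f i ∈ Ideal.span {c} := by
  rcases Nat.eq_zero_or_pos Q with rfl | hQ
  · exact ⟨0, by simp, by simp⟩
  · obtain ⟨j, hj, hmax⟩ := Finset.exists_max_image (Finset.range Q) (fun i => ‖f i‖)
      ⟨0, Finset.mem_range.2 hQ⟩
    exact ⟨f j, mem_maximalIdeal_iff.1 (hf j (Finset.mem_range.1 hj)), fun i hi =>
      Ideal.mem_span_singleton.2 (dvd_iff_norm_le.2 (hmax i (Finset.mem_range.2 hi)))⟩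

/-- Weierstrass preparation, for a power series over the valuation ring of a complete field whose
reduction modulo the maximal ideal has finite order. -/
theorem exists_weierstrass [CompleteSpace K] {f : PowerSeries (Valued.integer K)} {Q : ℕ}
    (hlt : ∀ i < Q, PowerSeries.coeff i f ∈ maximalIdeal (Valued.integer K))
    (hQ : PowerSeries.coeff Q f ∉ maximalIdeal (Valued.integer K)) :
    ∃ (q : PowerSeries (Valued.integer K)) (r : Polynomial (Valued.integer K)), r.degree < Q ∧
      (∀ i, r.coeff i ∈ maximalIdeal (Valued.integer K)) ∧
      PowerSeries.constantCoeff q ∉ maximalIdeal (Valued.integer K) ∧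
      PowerSeries.X ^ Q = f * q + (r : PowerSeries (Valued.integer K)) := by
  -- The division theorem needs an adically complete ring. The maximal ideal does not qualify, but
  -- the principal ideal of the largest of the finitely many coefficients below degree `Q` does.
  obtain ⟨c, hc, hfc⟩ := exists_span_singleton_of_forall_mem_maximalIdeal hlt
  have hI : Ideal.span {c} ≤ maximalIdeal (Valued.integer K) :=
    (Ideal.span_singleton_le_iff_mem _).2 (mem_maximalIdeal_iff.2 hc)
  have _ := isAdicComplete_span hc
  have hord : (f.map (Ideal.Quotient.mk (Ideal.span {c}))).order.toNat = Q := by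
    rw [(PowerSeries.order_eq_nat (n := Q)).2, ENat.toNat_natCast]
    refine ⟨?_, fun i hi => ?_⟩
    · rw [PowerSeries.coeff_map, ne_eq, Ideal.Quotient.eq_zero_iff_mem]
      exact fun h => hQ (hI h)
    · rw [PowerSeries.coeff_map, Ideal.Quotient.eq_zero_iff_mem]
      exact hfc i hi
  have H : f.IsWeierstrassDivisorAt (Ideal.span {c}) := by
    rw [PowerSeries.IsWeierstrassDivisorAt, hord]
    simpa using hQ
  have D := H.isWeierstrassDivisionAt_div_mod (PowerSeries.X ^ Q)
  generalize H.div (PowerSeries.X ^ Q) = q at D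
  generalize H.mod (PowerSeries.X ^ Q) = r at D
  have hdeg := D.degree_lt
  rw [hord] at hdeg
  refine ⟨q, r, hdeg, fun i => ?_, fun hq => ?_, D.eq_mul_add⟩
  · rcases lt_or_ge i Q with hi | hi
    · have h := D.coeff_f_sub_r_mem (i := i) (by rwa [hord])
      rw [map_sub, PowerSeries.coeff_X_pow, if_neg hi.ne, zero_sub, Polynomial.coeff_coe,
        neg_mem_iff] at h
      exact hI h
    · rw [Polynomial.coeff_eq_zero_of_degree_lt (hdeg.trans_le (by exact_mod_cast hi))]
      exact zero_mem _
  · -- Compare the coefficients of `X ^ Q`: if `q` were not a unit, then `1` would not be one.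
    have h := congrArg (PowerSeries.coeff Q) D.eq_mul_add
    rw [PowerSeries.coeff_X_pow_self, map_add, Polynomial.coeff_coe,
      Polynomial.coeff_eq_zero_of_degree_lt hdeg, add_zero, PowerSeries.coeff_mul] at h
    refine (Ideal.ne_top_iff_one _).1 (maximalIdeal.isMaximal (Valued.integer K)).ne_top
      (h ▸ Ideal.sum_mem _ fun x hx => ?_)
    rw [Finset.HasAntidiagonal.mem_antidiagonal] at hx
    rcases lt_or_ge x.1 Q with hi | hi
    · exact Ideal.mul_mem_right _ _ (hlt _ hi)
    · have h2 : x.2 = 0 := by omega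
      rw [h2, PowerSeries.coeff_zero_eq_constantCoeff_apply]
      exact Ideal.mul_mem_left _ _ hq

theorem exists_ringHom_evalAt_polynomial [CompleteSpace K] {x : Valued.integer K}
    (hx : x ∈ maximalIdeal (Valued.integer K)) :
    ∃ φ : PowerSeries (Valued.integer K) →+* Valued.integer K,
      (∀ f, φ f = evalAt f fun _ => x) ∧ φ PowerSeries.X = x ∧
        (∀ a, φ (PowerSeries.C a) = a) ∧ ∀ P : Polynomial (Valued.integer K), φ P = P.eval x := by
  obtain ⟨φ, hφ, hs⟩ := exists_ringHom_hasSum_evalAt (σ := Unit) (a := fun _ => x) fun _ => hx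
  have hX : φ PowerSeries.X = x := by rw [PowerSeries.X, hφ, evalAt_X]
  have hC : ∀ a, φ (PowerSeries.C a) = a := fun a => by
    classical
    rw [hφ, evalAt, tsum_eq_single 0]
    · simp [PowerSeries.C]
    · intro d hd
      change MvPowerSeries.coeff d (MvPowerSeries.C a) * _ = 0
      rw [MvPowerSeries.coeff_C, if_neg hd, zero_mul]
  refine ⟨φ, hφ, hX, hC, fun P => ?_⟩
  have : (φ : PowerSeries (Valued.integer K) →+* Valued.integer K).comp
      Polynomial.coeToPowerSeries.ringHom = Polynomial.evalRingHom x :=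
    Polynomial.ringHom_ext (by simp [hC]) (by simp [hX])
  exact congrArg (fun g => g P) this

theorem norm_eq_one_of_notMem {x : Valued.integer K} (hx : x ∉ maximalIdeal (Valued.integer K)) :
    ‖x‖ = 1 :=
  Valued.integer.isUnit_iff_norm_eq_one.1 (by simpa using hx)

/-- Over an algebraically closed complete field, a power series with integral coefficients whose
reduction has order `Q` has exactly `Q` roots in the open unit disc, and its values there have the
size of the product of the distances to the roots. -/
theorem exists_roots [CompleteSpace K] [IsAlgClosed K] {f : PowerSeries (Valued.integer K)} {Q : ℕ}
    (hlt : ∀ i < Q, PowerSeries.coeff i f ∈ maximalIdeal (Valued.integer K))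
    (hQ : PowerSeries.coeff Q f ∉ maximalIdeal (Valued.integer K)) :
    ∃ Z : Multiset (Valued.integer K), Multiset.card Z = Q ∧
      (∀ z ∈ Z, z ∈ maximalIdeal (Valued.integer K)) ∧
      ∀ x ∈ maximalIdeal (Valued.integer K),
        ‖evalAt f fun _ => x‖ = (Z.map fun z => ‖x - z‖).prod := by
  obtain ⟨q, r, hdeg, hr, hq, h⟩ := exists_weierstrass hlt hQ
  -- The polynomial `P` is `f` times a unit and reduces to `X ^ Q`, so all its roots are small.
  set P : Polynomial (Valued.integer K) := Polynomial.X ^ Q - r with hP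
  have hmon : P.Monic := Polynomial.monic_X_pow_sub hdeg
  have hnat : P.natDegree = Q := by
    have : P.degree = Q := by
      rw [hP, Polynomial.degree_sub_eq_left_of_degree_lt (by rwa [Polynomial.degree_X_pow]),
        Polynomial.degree_X_pow]
    exact Polynomial.natDegree_eq_of_degree_eq_some this
  let PK : Polynomial K := P.map (Valued.integer K).subtype
  have hmonK : PK.Monic := hmon.map _
  have hsplit : PK = (PK.roots.map fun a => Polynomial.X - Polynomial.C a).prod := by
    have := (IsAlgClosed.splits PK).eq_prod_roots
    rwa [hmonK.leadingCoeff, Polynomial.C_1, one_mul] at this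
  have hroot : ∀ z ∈ PK.roots, ∃ y ∈ maximalIdeal (Valued.integer K), (y : K) = z := by
    intro z hz
    have hz0 : Polynomial.eval₂ (Valued.integer K).subtype z P = 0 := by
      rw [← Polynomial.eval_map]
      exact (Polynomial.mem_roots'.1 hz).2
    obtain ⟨y, rfl⟩ := IsIntegrallyClosed.isIntegral_iff.1
      (⟨P, hmon, hz0⟩ : IsIntegral (Valued.integer K) z)
    refine ⟨y, ?_, rfl⟩
    have hy0 : P.eval y = 0 := by
      have h1 := Polynomial.hom_eval₂ P (RingHom.id _) (Valued.integer K).subtype y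
      rw [RingHom.comp_id] at h1
      exact Subtype.ext (h1.trans hz0)
    rw [hP, Polynomial.eval_sub, Polynomial.eval_pow, Polynomial.eval_X, sub_eq_zero] at hy0
    refine Ideal.IsPrime.mem_of_pow_mem inferInstance Q ?_
    rw [hy0, Polynomial.eval_eq_sum_range]
    exact Ideal.sum_mem _ fun i _ => Ideal.mul_mem_right _ _ (hr i)
  obtain ⟨Z, hZ⟩ : ∃ Z : Multiset (Valued.integer K), Z.map Subtype.val = PK.roots :=
    CanLift.prf (β := Multiset (Valued.integer K)) PK.roots fun z hz => by
      obtain ⟨y, -, rfl⟩ := hroot z hz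
      exact y.2
  refine ⟨Z, ?_, fun z hz => ?_, fun x hx => ?_⟩
  · rw [← Multiset.card_map Subtype.val Z, hZ,
      ← hnat, ← hmon.natDegree_map (Valued.integer K).subtype]
    exact (IsAlgClosed.splits PK).natDegree_eq_card_roots.symm
  · obtain ⟨y, hy, hyz⟩ := hroot z (hZ ▸ Multiset.mem_map_of_mem _ hz)
    rwa [← Subtype.ext hyz]
  · obtain ⟨φ, hφ, hX, hC, hpol⟩ := exists_ringHom_evalAt_polynomial hx
    have hqu : ‖φ q‖ = 1 := by
      refine norm_eq_one_of_notMem fun hm => hq ?_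
      have h1 : φ (q - PowerSeries.C (PowerSeries.constantCoeff q)) ∈
          maximalIdeal (Valued.integer K) := by
        rw [hφ]
        refine evalAt_mem ?_ fun _ => hx
        change PowerSeries.constantCoeff _ = 0
        simp
      rw [map_sub, hC] at h1
      simpa using Ideal.sub_mem _ hm h1
    have hfq : φ f * φ q = P.eval x := by
      have := congrArg φ h
      rw [map_pow, hX, map_add, map_mul, hpol] at this
      rw [hP, Polynomial.eval_sub, Polynomial.eval_pow, Polynomial.eval_X, this]
      ring
    have hPx : ((P.eval x : Valued.integer K) : K) = PK.eval (x : K) := by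
      rw [Polynomial.eval_map]
      have h1 := Polynomial.hom_eval₂ P (RingHom.id _) (Valued.integer K).subtype x
      rwa [RingHom.comp_id] at h1
    calc ‖evalAt f fun _ => x‖ = ‖φ f * φ q‖ := by rw [norm_mul, hqu, mul_one, hφ]
      _ = ‖PK.eval (x : K)‖ := by rw [hfq, ← hPx]; rfl
      _ = (Z.map fun z => ‖x - z‖).prod := by
        rw [hsplit, ← hZ, Polynomial.eval_multiset_prod, Multiset.map_map]
        refine (map_multiset_prod (normHom : K →*₀ ℝ) _).trans (congrArg Multiset.prod ?_)
        rw [Multiset.map_map, Multiset.map_map]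
        refine Multiset.map_congr rfl fun z _ => ?_
        simp [normHom]

end Roots

/-! ### The size of a point -/

section PointNorm

variable {F K : Type*} [NontriviallyNormedField F] [IsUltrametricDist F]
  [NontriviallyNormedField K] [IsUltrametricDist K] [NormedAlgebra F K]
  {H : FormalModule (Valued.integer F) (Valued.integer K)}

/-- The absolute value of the coordinate of a point. -/
def Points.size (x : Points H) : ℝ≥0 := ‖x.coord‖₊

theorem Points.size_lt_one (x : Points H) : x.size < 1 :=
  mem_maximalIdeal_iff.1 x.coord_mem

theorem Points.size_eq_zero {x : Points H} : x.size = 0 ↔ x = 0 := by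
  rw [Points.size, nnnorm_eq_zero]
  exact ⟨fun h => Points.ext h, fun h => h ▸ rfl⟩

theorem Points.exists_coord {c : Valued.integer K} (hc : c ∈ maximalIdeal (Valued.integer K)) :
    ∃ x : Points H, x.coord = c := ⟨⟨c, hc⟩, rfl⟩

@[simp] theorem Points.size_zero : (0 : Points H).size = 0 := Points.size_eq_zero.2 rfl

theorem Points.size_add_le (x y : Points H) : (x + y).size ≤ max x.size y.size := by
  have h : ‖(x + y).coord‖ ≤ max ‖x.coord‖ ‖y.coord‖ := by
    refine norm_evalAt_le H.zero_constantCoeff (le_max_of_le_left (norm_nonneg _)) fun s => ?_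
    fin_cases s
    · exact le_max_left _ _
    · exact le_max_right _ _
  exact_mod_cast h

theorem Points.size_smul_le (a : Valued.integer F) (x : Points H) : (a • x).size ≤ x.size :=
  norm_evalAt_le (H.constantCoeff_act a) (norm_nonneg _) fun _ => le_rfl

variable [CompleteSpace K]

theorem Points.size_neg (x : Points H) : (-x).size = x.size := by
  have h : ∀ y : Points H, (-y).size ≤ y.size := fun y => by
    rw [← neg_one_smul (Valued.integer F) y]
    exact Points.size_smul_le _ _
  exact le_antisymm (h x) (by simpa using h (-x))

theorem Points.size_sub_comm (x y : Points H) : (x - y).size = (y - x).size := by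
  rw [← neg_sub, Points.size_neg]

theorem Points.size_sub_le (x y : Points H) : (x - y).size ≤ max x.size y.size := by
  rw [sub_eq_add_neg, ← Points.size_neg y]
  exact Points.size_add_le _ _

/-- Modulo terms of degree at least two divisible by `X`, the formal group law is `F(0, Y) + X`. -/
theorem Points.norm_coord_add_sub_coord (x y : Points H) :
    ‖(x + y).coord - y.coord‖ = ‖x.coord‖ := by
  by_cases hx0 : x = 0
  · rw [hx0, zero_add, sub_self, Points.coord_zero]
  have hpos : 0 < ‖x.coord‖ := by
    rw [norm_pos_iff]
    exact fun h => hx0 (Points.ext h)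
  set a := x.coord with ha
  set b := y.coord with hb
  have hm : ∀ c : Points H, ∀ s, ![c.coord, b] s ∈ maximalIdeal (Valued.integer K) := by
    intro c s; fin_cases s
    · exact c.coord_mem
    · exact y.coord_mem
  obtain ⟨-, -, h1⟩ := exists_ringHom_hasSum_evalAt (hm x)
  obtain ⟨-, -, h2⟩ := exists_ringHom_hasSum_evalAt (hm 0)
  have h3 := (h1 H.toPowerSeries).sub (h2 H.toPowerSeries)
  have hadd : (x + y).coord - b = evalAt H.toPowerSeries ![a, b] -
      evalAt H.toPowerSeries ![(0 : Points H).coord, b] := by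
    rw [ha, hb, ← Points.coord_add, ← Points.coord_add, zero_add]
  have hsum := h3.sub (hasSum_ite_eq (Finsupp.single (0 : Fin 2) 1) a)
  have hlt : ‖(x + y).coord - b - a‖ < ‖a‖ := by
    rw [hadd, ← hsum.tsum_eq]
    refine lt_of_le_of_lt ((IsUltrametricDist.norm_tsum_le _).trans
      (Real.iSup_le (fun d => ?_) (a := ‖a‖ * max ‖a‖ ‖b‖) (by positivity))) ?_
    · have hfin : ∀ u : Fin 2 → Valued.integer K, (d.prod fun s e => u s ^ e) =
          u 0 ^ d 0 * u 1 ^ d 1 := fun u => by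
        rw [Finsupp.prod_fintype _ _ fun i => pow_zero _, Fin.prod_univ_two]
      rw [hfin, hfin]
      simp only [Matrix.cons_val_zero, Matrix.cons_val_one, Points.coord_zero]
      rcases Nat.eq_zero_or_pos (d 0) with h0 | h0
      · have hd : d ≠ Finsupp.single 0 1 := fun h => by simp [h] at h0
        rw [h0, if_neg hd]
        simp only [pow_zero, sub_self, norm_zero]
        positivity
      · rw [zero_pow h0.ne', zero_mul, mul_zero, sub_zero]
        by_cases hd : d = Finsupp.single 0 1
        · rw [if_pos hd, hd, H.lin_coeff_X]
          have h1 : (Finsupp.single (0 : Fin 2) 1 : Fin 2 →₀ ℕ) 1 = 0 := by simp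
          rw [h1, Finsupp.single_eq_same, pow_one, pow_zero, mul_one, one_mul, sub_self, norm_zero]
          positivity
        · rw [if_neg hd, sub_zero]
          obtain ⟨k, hk⟩ := Nat.exists_eq_succ_of_ne_zero h0.ne'
          have hb1 : ‖b‖ ≤ 1 := Valued.integer.norm_le_one _
          have ha1 : ‖a‖ ≤ 1 := Valued.integer.norm_le_one _
          have hkey : ‖a‖ ^ k * ‖b‖ ^ d 1 ≤ max ‖a‖ ‖b‖ := by
            rcases Nat.eq_zero_or_pos (d 1) with h1 | h1
            · have hk0 : k ≠ 0 := by
                rintro rfl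
                refine hd (Finsupp.ext fun i => ?_)
                fin_cases i
                · simpa using hk
                · simpa using h1
              rw [h1, pow_zero, mul_one]
              exact (pow_le_of_le_one (norm_nonneg _) ha1 hk0).trans (le_max_left _ _)
            · exact (mul_le_of_le_one_left (by positivity)
                (pow_le_one₀ (norm_nonneg _) ha1)).trans
                  ((pow_le_of_le_one (norm_nonneg _) hb1 h1.ne').trans (le_max_right _ _))
          rw [norm_mul, norm_mul, norm_pow, norm_pow, hk, pow_succ', mul_assoc]
          exact (mul_le_of_le_one_left (by positivity) (Valued.integer.norm_le_one _)).trans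
            (mul_le_mul_of_nonneg_left hkey (norm_nonneg _))
    · refine mul_lt_of_lt_one_right hpos (max_lt ?_ ?_)
      · exact mem_maximalIdeal_iff.1 x.coord_mem
      · exact mem_maximalIdeal_iff.1 y.coord_mem
  have := IsUltrametricDist.norm_add_eq_max_of_norm_ne_norm hlt.ne
  rwa [sub_add_cancel, max_eq_right hlt.le] at this

/-- Formal subtraction and subtraction of coordinates have the same size. -/
theorem Points.size_sub (x y : Points H) : (x - y).size = ‖x.coord - y.coord‖₊ := by
  have h := Points.norm_coord_add_sub_coord (x - y) y
  rw [sub_add_cancel] at h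
  exact NNReal.eq h.symm

/-- The series `[a](T)` acts by multiplication by `a` to first order. -/
theorem Points.size_smul_of_size_lt {a : Valued.integer F} {x : Points H}
    (hx : x.size < ‖a‖₊) : (a • x).size = ‖a‖₊ * x.size := by
  by_cases hx0 : x = 0
  · simp [hx0]
  have hpos : 0 < ‖x.coord‖ := by
    rw [norm_pos_iff]
    exact fun h => hx0 (Points.ext h)
  have hxa : ‖x.coord‖ < ‖a‖ := hx
  obtain ⟨-, -, h1⟩ := exists_ringHom_hasSum_evalAt (σ := Unit) (a := fun _ => x.coord)
    fun _ => x.coord_mem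
  set b := x.coord with hb
  set c := algebraMap (Valued.integer F) (Valued.integer K) a with hc
  have hca : ‖c‖ = ‖a‖ := norm_algebraMap' K (a : F)
  have hsum := (h1 (H.act a)).sub (hasSum_ite_eq (Finsupp.single () 1) (c * b))
  have hlt : ‖(a • x).coord - c * b‖ < ‖c * b‖ := by
    rw [Points.coord_smul, ← hsum.tsum_eq]
    refine lt_of_le_of_lt ((IsUltrametricDist.norm_tsum_le _).trans
      (Real.iSup_le (fun d => ?_) (a := ‖b‖ * ‖b‖) (by positivity))) ?_
    · have hfin : (d.prod fun _ e => b ^ e) = b ^ d () := by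
        rw [Finsupp.prod_fintype _ _ fun i => pow_zero _, Fintype.prod_unique]
      rw [hfin]
      by_cases hd : d = Finsupp.single () 1
      · have h2 : MvPowerSeries.coeff (Finsupp.single () 1) (H.act a) = c := H.coeff_one_act a
        rw [if_pos hd, hd, h2, Finsupp.single_eq_same, pow_one, sub_self, norm_zero]
        positivity
      · rw [if_neg hd, sub_zero]
        by_cases hd0 : d = 0
        · rw [hd0, MvPowerSeries.coeff_zero_eq_constantCoeff_apply]
          have h2 : MvPowerSeries.constantCoeff (H.act a) = 0 := H.constantCoeff_act a
          rw [h2, zero_mul, norm_zero]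
          positivity
        · obtain ⟨k, hk⟩ : ∃ k, d () = k + 2 := by
            refine Nat.exists_eq_add_of_le' ?_
            by_contra! hlt
            interval_cases h : d ()
            · exact hd0 (Finsupp.ext fun _ => h)
            · exact hd (Finsupp.ext fun _ => by simpa using h)
          rw [norm_mul, norm_pow, hk, pow_add, pow_two]
          exact (mul_le_of_le_one_left (by positivity) (Valued.integer.norm_le_one _)).trans
            (mul_le_of_le_one_left (by positivity)
              (pow_le_one₀ (norm_nonneg _) (Valued.integer.norm_le_one _)))
    · rw [norm_mul, hca]
      exact mul_lt_mul_of_pos_right hxa hpos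
  have h3 := IsUltrametricDist.norm_add_eq_max_of_norm_ne_norm hlt.ne
  rw [sub_add_cancel, max_eq_right hlt.le, norm_mul, hca] at h3
  exact NNReal.eq h3

end PointNorm

/-! ### The kernel of multiplication by the uniformizer -/

section Kernel

variable {F K : Type*} [NontriviallyNormedField F] [IsUltrametricDist F]
  [NontriviallyNormedField K] [IsUltrametricDist K] [NormedAlgebra F K]
  {H : FormalModule (Valued.integer F) (Valued.integer K)} {π : Uniformizer F}

theorem norm_uniformizer_lt_one (π : Uniformizer F) : ‖π.1‖₊ < 1 :=
  Valued.integer.norm_irreducible_lt_one π.2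

theorem norm_uniformizer_pos (π : Uniformizer F) : 0 < ‖π.1‖₊ :=
  Valued.integer.norm_irreducible_pos π.2

theorem HasHeight.coeff_mem {n : ℕ} (hn : HasHeight H π n) {i : ℕ}
    (hi : i < Nat.card (ResidueField (Valued.integer F)) ^ n) :
    PowerSeries.coeff i (H.act π.1) ∈ maximalIdeal (Valued.integer K) := by
  have h := PowerSeries.coeff_of_lt_order (φ := PowerSeries.map (residue (Valued.integer K))
    (H.act π.1)) i (by rw [hn]; exact_mod_cast hi)
  rwa [PowerSeries.coeff_map, residue_eq_zero_iff] at h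

theorem HasHeight.coeff_notMem {n : ℕ} (hn : HasHeight H π n) :
    PowerSeries.coeff (Nat.card (ResidueField (Valued.integer F)) ^ n) (H.act π.1) ∉
      maximalIdeal (Valued.integer K) := by
  have h := (PowerSeries.order_eq_nat.1 hn).1
  rwa [PowerSeries.coeff_map, ne_eq, residue_eq_zero_iff] at h

/-- The reduction of `[π](T) = π T + ⋯` has no terms of degree less than two. -/
theorem HasHeight.one_lt {n : ℕ} (hn : HasHeight H π n) :
    1 < Nat.card (ResidueField (Valued.integer F)) ^ n := by
  have h := hn.coeff_notMem
  by_contra! hle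
  interval_cases hc : Nat.card (ResidueField (Valued.integer F)) ^ n
  · rw [PowerSeries.coeff_zero_eq_constantCoeff_apply, H.constantCoeff_act] at h
    exact h (zero_mem _)
  · rw [H.coeff_one_act] at h
    refine h (mem_maximalIdeal_iff.2 ?_)
    have h1 : ‖algebraMap (Valued.integer F) (Valued.integer K) π.1‖ = ‖π.1‖ :=
      norm_algebraMap' K (π.1 : F)
    rw [h1]
    exact norm_uniformizer_lt_one π

/-- The multiplicative form of the function by which multiplication by the uniformizer renumbers
the lower ramification filtration. -/
def renumber (Z : Finset (Points H)) (r : ℝ≥0) : ℝ≥0 := ∏ z ∈ Z, max z.size r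

theorem continuous_renumber (Z : Finset (Points H)) : Continuous (renumber Z) :=
  continuous_finsetProd _ fun _ _ => continuous_const.max continuous_id

theorem renumber_eq_pow {Z : Finset (Points H)} {δ r : ℝ≥0} (hδ : ∀ z ∈ Z, z.size ≤ δ)
    (hr : δ ≤ r) : renumber Z r = r ^ Z.card := by
  rw [renumber, Finset.prod_congr rfl fun z hz => max_eq_right ((hδ z hz).trans hr),
    Finset.prod_const]

theorem pow_le_renumber (Z : Finset (Points H)) (r : ℝ≥0) : r ^ Z.card ≤ renumber Z r := by
  rw [renumber, ← Finset.prod_const]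
  exact Finset.prod_le_prod' fun z _ => le_max_right _ _

theorem exists_forall_size_le (Z : Finset (Points H)) :
    ∃ δ : ℝ≥0, 0 < δ ∧ δ < 1 ∧ ∀ z ∈ Z, z.size ≤ δ := by
  refine ⟨max (Z.sup Points.size) (1 / 2), lt_max_of_lt_right (by norm_num), max_lt ?_ ?_,
    fun z hz => le_max_of_le_left (Finset.le_sup hz)⟩
  · exact (Finset.sup_lt_iff (by simp)).2 fun z _ => z.size_lt_one
  · exact NNReal.half_lt_self one_ne_zero

theorem pow_le_iterate_renumber (Z : Finset (Points H)) (r : ℝ≥0) (k : ℕ) :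
    r ^ Z.card ^ k ≤ (renumber Z)^[k] r := by
  induction k with
  | zero => simp
  | succ k ih =>
    rw [Function.iterate_succ_apply', pow_succ, pow_mul]
    exact (pow_le_pow_left₀ bot_le ih _).trans (pow_le_renumber Z _)

variable [CompleteSpace K]

/-- The fibre of `[π]` over `y`, with multiplicities. -/
theorem Points.exists_multiset [IsAlgClosed K] {n : ℕ} (hn : HasHeight H π n) (y : Points H) :
    ∃ Z : Multiset (Points H),
      Multiset.card Z = Nat.card (ResidueField (Valued.integer F)) ^ n ∧
      ∀ x : Points H, (π.1 • x - y).size = (Z.map fun z => (x - z).size).prod := by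
  let ofCoord : ∀ z ∈ maximalIdeal (Valued.integer K), Points H := fun z hz => ⟨z, hz⟩
  set Q := Nat.card (ResidueField (Valued.integer F)) ^ n with hQ
  have hQ1 : 1 < Q := hn.one_lt
  obtain ⟨Z, hcard, hmem, hprod⟩ := exists_roots (f := H.act π.1 - PowerSeries.C y.coord) (Q := Q)
    (fun i hi => by
      rw [map_sub, PowerSeries.coeff_C]
      refine sub_mem (hn.coeff_mem hi) ?_
      split_ifs
      · exact y.coord_mem
      · exact zero_mem _)
    (by
      rw [map_sub, PowerSeries.coeff_C, if_neg (by omega), sub_zero]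
      exact hn.coeff_notMem)
  refine ⟨Z.pmap (fun z hz => ofCoord z hz) hmem, by rw [Multiset.card_pmap, hcard],
    fun x => ?_⟩
  obtain ⟨φ, hφ, -, hC, -⟩ := exists_ringHom_evalAt_polynomial x.coord_mem
  have h := hprod x.coord x.coord_mem
  rw [← hφ, map_sub, hC, hφ, ← Points.coord_smul] at h
  rw [Points.size_sub]
  refine NNReal.eq (h.trans ?_)
  rw [Multiset.map_pmap, NNReal.coe_multiset_prod, Multiset.map_pmap,
    ← Multiset.pmap_eq_map (p := fun z => z ∈ maximalIdeal (Valued.integer K)) _ _ hmem]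
  refine congrArg _ (Multiset.pmap_congr Z fun z hz h1 h2 => ?_)
  rw [Points.size_sub]
  rfl

/-- `[π]` is surjective on points. -/
theorem Points.exists_smul_eq [IsAlgClosed K] {n : ℕ} (hn : HasHeight H π n) (y : Points H) :
    ∃ x : Points H, π.1 • x = y := by
  obtain ⟨Z, hcard, hprod⟩ := Points.exists_multiset hn y
  obtain ⟨z, hz⟩ := Multiset.card_pos_iff_exists_mem.1
    (hcard ▸ zero_lt_one.trans hn.one_lt : 0 < Multiset.card Z)
  refine ⟨z, sub_eq_zero.1 (Points.size_eq_zero.1 ?_)⟩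
  rw [hprod]
  exact Multiset.prod_eq_zero (Multiset.mem_map.2 ⟨z, hz, by simp⟩)

/-- `Z` is the kernel of `[π]` on points, and the size of `[π](x)` is the product of the distances
of `x` to the elements of `Z`. -/
structure IsKernel (π : Uniformizer F) (Z : Finset (Points H)) : Prop where
  mem_iff : ∀ z, z ∈ Z ↔ π.1 • z = 0
  size_smul : ∀ x, (π.1 • x).size = ∏ z ∈ Z, (x - z).size

/-- The kernel of `[π]` has `q ^ n` elements. The roots of `[π](T)` are simple because near a root
`z` the size of `[π](x)` is `|π| |x - z|`, by translation to the origin. -/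
theorem exists_isKernel [IsAlgClosed K] {n : ℕ} (hn : HasHeight H π n) :
    ∃ Z : Finset (Points H), IsKernel π Z ∧
      Z.card = Nat.card (ResidueField (Valued.integer F)) ^ n := by
  obtain ⟨Z, hcard, hprod⟩ := Points.exists_multiset hn (0 : Points H)
  simp only [sub_zero] at hprod
  have hmem : ∀ z, z ∈ Z ↔ π.1 • z = 0 := fun z => by
    rw [← Points.size_eq_zero, hprod, Multiset.prod_eq_zero_iff, Multiset.mem_map]
    constructor
    · exact fun h => ⟨z, h, by simp⟩
    · rintro ⟨w, hw, h⟩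
      rwa [sub_eq_zero.1 (Points.size_eq_zero.1 h)]
  have hnodup : Z.Nodup := by
    rw [Multiset.nodup_iff_le]
    intro z hle
    obtain ⟨Z', rfl⟩ := Multiset.le_iff_exists_add.1 hle
    have hz : π.1 • z = 0 := (hmem z).1 (by simp)
    have hπ1 := norm_uniformizer_lt_one π
    have hπ0 := norm_uniformizer_pos π
    -- If `z` were a double root, then `|[π](z + w)| ≤ |w| ^ 2` for every point `w`; this
    -- contradicts `|[π](w)| = |π| |w|` as soon as `0 < |w| < |π|`, for instance for `w = π ^ 2`.
    obtain ⟨w, hw⟩ := Points.exists_coord (H := H)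
      (c := algebraMap (Valued.integer F) (Valued.integer K) (π.1 ^ 2)) (by
        rw [mem_maximalIdeal_iff, map_pow, norm_pow]
        have h1 : ‖algebraMap (Valued.integer F) (Valued.integer K) π.1‖ = ‖π.1‖ :=
          norm_algebraMap' K (π.1 : F)
        rw [h1]
        exact pow_lt_one₀ (norm_nonneg _) hπ1 two_ne_zero)
    have hws : w.size = ‖π.1‖₊ ^ 2 := by
      rw [Points.size, hw, map_pow, nnnorm_pow]
      congr 1
      exact NNReal.eq (norm_algebraMap' K (π.1 : F))
    have hlt : w.size < ‖π.1‖₊ := by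
      rw [hws]
      exact pow_lt_self_of_lt_one₀ hπ0 hπ1 one_lt_two
    have hw0 : 0 < w.size := hws ▸ pow_pos hπ0 2
    have h1 := hprod (z + w)
    rw [smul_add, hz, zero_add, Points.size_smul_of_size_lt hlt] at h1
    simp only [Multiset.cons_add,
      Multiset.zero_add, Multiset.map_cons, Multiset.prod_cons, add_sub_cancel_left] at h1
    have h2 : (Z'.map fun u => (z + w - u).size).prod ≤ 1 := by
      refine (Multiset.prod_le_pow_card _ 1 fun r hr => ?_).trans (one_pow _).le
      obtain ⟨u, -, rfl⟩ := Multiset.mem_map.1 hr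
      exact (Points.size_lt_one _).le
    have h3 : ‖π.1‖₊ * w.size ≤ w.size * w.size := by
      rw [h1]
      exact mul_le_mul_right (mul_le_of_le_one_right' h2) _
    exact absurd (le_of_mul_le_mul_right h3 hw0) hlt.not_ge
  exact ⟨⟨Z, hnodup⟩, ⟨hmem, hprod⟩, hcard⟩

/-! ### The effect of multiplication by the uniformizer on sizes -/

namespace IsKernel

variable {Z : Finset (Points H)}

theorem zero_mem (hZ : IsKernel π Z) : 0 ∈ Z := (hZ.mem_iff 0).2 (smul_zero _)

theorem size_smul_le (hZ : IsKernel π Z) {x : Points H} {r : ℝ≥0} (h : x.size ≤ r) :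
    (π.1 • x).size ≤ renumber Z r := by
  rw [hZ.size_smul]
  refine Finset.prod_le_prod' fun z _ => (Points.size_sub_le x z).trans ?_
  rw [max_comm]
  exact max_le_max le_rfl h

/-- Every fibre of `[π]` contains a point `x` such that `|x - z| = max |x| |z|` for all `z` in the
kernel, namely a point of minimal size. -/
theorem exists_size_smul_eq (hZ : IsKernel π Z) (x : Points H) :
    ∃ z ∈ Z, (π.1 • x).size = renumber Z (x - z).size := by
  obtain ⟨z₀, hz₀, hmin⟩ := Finset.exists_min_image Z (fun z => (x - z).size) ⟨0, hZ.zero_mem⟩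
  refine ⟨z₀, hz₀, ?_⟩
  have h0 : π.1 • x = π.1 • (x - z₀) := by rw [smul_sub, (hZ.mem_iff z₀).1 hz₀, sub_zero]
  rw [h0, hZ.size_smul]
  refine Finset.prod_congr rfl fun z hz => ?_
  have h1 : (x - z₀).size ≤ (x - z₀ - z).size := by
    rw [sub_sub]
    refine hmin _ ((hZ.mem_iff _).2 ?_)
    rw [smul_add, (hZ.mem_iff z₀).1 hz₀, (hZ.mem_iff z).1 hz, add_zero]
  refine le_antisymm ((Points.size_sub_le _ _).trans (max_comm _ _).le) (max_le ?_ h1)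
  have h2 := Points.size_sub_le (x - z₀) (x - z₀ - z)
  rw [sub_sub_cancel, max_eq_right h1] at h2
  exact h2

theorem renumber_eq_mul (hZ : IsKernel π Z) (r : ℝ≥0) [DecidableEq (Points H)] :
    renumber Z r = r * ∏ z ∈ Z.erase 0, max z.size r := by
  rw [renumber, ← Finset.mul_prod_erase Z _ hZ.zero_mem, Points.size_zero, max_eq_right zero_le]

theorem strictMono_renumber (hZ : IsKernel π Z) : StrictMono (renumber Z) := by
  classical
  intro r s hrs
  rw [hZ.renumber_eq_mul, hZ.renumber_eq_mul]
  have hle : ∏ z ∈ Z.erase 0, max z.size r ≤ ∏ z ∈ Z.erase 0, max z.size s :=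
    Finset.prod_le_prod' fun z _ => max_le_max le_rfl hrs.le
  have hpos : 0 < ∏ z ∈ Z.erase 0, max z.size s :=
    Finset.prod_pos fun z _ => lt_max_of_lt_right (bot_le.trans_lt hrs)
  exact (mul_le_mul_right hle r).trans_lt (mul_lt_mul_of_pos_right hrs hpos)

theorem exists_sub_size_le (hZ : IsKernel π Z) {x : Points H} {r : ℝ≥0}
    (h : (π.1 • x).size ≤ renumber Z r) : ∃ z ∈ Z, (x - z).size ≤ r := by
  obtain ⟨z, hz, he⟩ := hZ.exists_size_smul_eq x
  exact ⟨z, hz, hZ.strictMono_renumber.le_iff_le.1 (he ▸ h)⟩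

theorem renumber_le_mul (hZ : IsKernel π Z) (hcard : 1 < Z.card) {c r : ℝ≥0}
    (hc : ∀ z ∈ Z, z.size ≤ c) (hc1 : c ≤ 1) (hr : r ≤ c) : renumber Z r ≤ c * r := by
  classical
  rw [hZ.renumber_eq_mul, mul_comm c]
  refine mul_le_mul_right ?_ r
  calc ∏ z ∈ Z.erase 0, max z.size r ≤ ∏ z ∈ Z.erase 0, c :=
        Finset.prod_le_prod' fun z hz => max_le (hc z (Finset.mem_of_mem_erase hz)) hr
    _ = c ^ (Z.card - 1) := by rw [Finset.prod_const, Finset.card_erase_of_mem hZ.zero_mem]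
    _ ≤ c := pow_le_of_le_one bot_le hc1 (by omega)

theorem iterate_renumber_le (hZ : IsKernel π Z) (hcard : 1 < Z.card) {c r : ℝ≥0}
    (hc : ∀ z ∈ Z, z.size ≤ c) (hc1 : c ≤ 1) (hr : r ≤ c) (k : ℕ) :
    (renumber Z)^[k] r ≤ c ^ k * r := by
  induction k with
  | zero => simp
  | succ k ih =>
    rw [Function.iterate_succ_apply', pow_succ', mul_assoc]
    refine (hZ.renumber_le_mul hcard hc hc1 (ih.trans ?_)).trans (mul_le_mul_right ih c)
    exact (mul_le_of_le_one_left' (pow_le_one₀ bot_le hc1)).trans hr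

/-- Every positive size less than one is reached from a given size `δ` by renumbering. -/
theorem exists_iterate_renumber_eq (hZ : IsKernel π Z) (hcard : 1 < Z.card) {δ s : ℝ≥0} (hδ : δ < 1)
    (hs0 : 0 < s) (hs : s < 1) :
    ∃ (k : ℕ) (r : ℝ≥0), δ ≤ r ∧ r < 1 ∧ (renumber Z)^[k] r = s := by
  obtain ⟨c₀, hc0, hc1, hc⟩ := exists_forall_size_le Z
  set c := max c₀ δ
  have hcc : c < 1 := max_lt hc1 hδ
  obtain ⟨k, hk⟩ := exists_pow_lt_of_lt_one hs0 hcc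
  have hlow : (renumber Z)^[k] δ ≤ s :=
    (hZ.iterate_renumber_le hcard (fun z hz => (hc z hz).trans (le_max_left _ _)) hcc.le
      (le_max_right _ _) k).trans ((mul_le_of_le_one_right' hδ.le).trans hk.le)
  have hhigh : s ≤ (renumber Z)^[k] 1 := by
    refine hs.le.trans ?_
    simpa using pow_le_iterate_renumber Z 1 k
  have hcont : Continuous (renumber Z)^[k] := (continuous_renumber Z).iterate k
  obtain ⟨r, hr, hrs⟩ := intermediate_value_Icc hδ.le hcont.continuousOn ⟨hlow, hhigh⟩
  refine ⟨k, r, hr.1, lt_of_le_of_ne hr.2 ?_, hrs⟩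
  rintro rfl
  have h1 := pow_le_iterate_renumber Z 1 k
  rw [hrs, one_pow] at h1
  exact h1.not_gt hs

/-- Small torsion points vanish. -/
theorem exists_forall_size_lt_eq_zero (hZ : IsKernel π Z) :
    ∃ μ : ℝ≥0, 0 < μ ∧ ∀ (k : ℕ) (x : Points H), π.1 ^ k • x = 0 → x.size < μ → x = 0 := by
  classical
  obtain ⟨μ, hμ0, hμ⟩ : ∃ μ : ℝ≥0, 0 < μ ∧ ∀ z ∈ Z, z.size < μ → z = 0 := by
    by_cases hne : (Z.erase 0).Nonempty
    · obtain ⟨z₀, hz₀, hmin⟩ := Finset.exists_min_image (Z.erase 0) Points.size hne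
      refine ⟨z₀.size, pos_iff_ne_zero.2 fun h => Finset.ne_of_mem_erase hz₀
        (Points.size_eq_zero.1 h), fun z hz hlt => ?_⟩
      by_contra h
      exact (hmin z (Finset.mem_erase.2 ⟨h, hz⟩)).not_gt hlt
    · refine ⟨1, one_pos, fun z hz _ => ?_⟩
      by_contra h
      exact hne ⟨z, Finset.mem_erase.2 ⟨h, hz⟩⟩
  refine ⟨μ, hμ0, fun k => ?_⟩
  induction k with
  | zero => intro x hx _; simpa using hx
  | succ k ih =>
    intro x hx hlt
    rw [pow_succ, mul_smul] at hx
    exact hμ x ((hZ.mem_iff x).2 (ih _ hx ((Points.size_smul_le _ _).trans_lt hlt))) hlt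

/-- Torsion points of bounded size are killed by a common power of the uniformizer. -/
theorem exists_pow_smul_eq_zero (hZ : IsKernel π Z) (hcard : 1 < Z.card) {r : ℝ≥0} (hr : r < 1) :
    ∃ m : ℕ, ∀ (k : ℕ) (x : Points H), π.1 ^ k • x = 0 → x.size ≤ r → π.1 ^ m • x = 0 := by
  obtain ⟨μ, hμ0, hμ⟩ := hZ.exists_forall_size_lt_eq_zero
  obtain ⟨c₀, hc0, hc1, hc⟩ := exists_forall_size_le Z
  set c := max c₀ r
  have hcc : c < 1 := max_lt hc1 hr
  obtain ⟨m, hm⟩ := exists_pow_lt_of_lt_one hμ0 hcc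
  refine ⟨m, fun k x hk hx => hμ k _ (by rw [smul_comm, hk, smul_zero]) ?_⟩
  have h : ∀ j, (π.1 ^ j • x).size ≤ (renumber Z)^[j] r := fun j => by
    induction j with
    | zero => simpa using hx
    | succ j ih =>
      rw [pow_succ', mul_smul, Function.iterate_succ_apply']
      exact hZ.size_smul_le ih
  have h1 := hZ.iterate_renumber_le hcard (fun z hz => (hc z hz).trans (le_max_left _ _)) hcc.le
    (le_max_right c₀ r) m
  exact (h m).trans_lt ((h1.trans (mul_le_of_le_one_right' hr.le)).trans_lt hm)

/-- On points at least as large as all elements of the kernel, `[π]` raises sizes to the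
power of the order of the kernel. -/
theorem size_smul_le_pow_iff (hZ : IsKernel π Z) {δ r : ℝ≥0} (hδ : ∀ z ∈ Z, z.size ≤ δ)
    (hr : δ ≤ r) {x : Points H} : (π.1 • x).size ≤ r ^ Z.card ↔ x.size ≤ r := by
  rw [← renumber_eq_pow hδ hr]
  refine ⟨fun h => ?_, hZ.size_smul_le⟩
  obtain ⟨z, hz, hle⟩ := hZ.exists_sub_size_le h
  rw [← sub_add_cancel x z]
  exact (Points.size_add_le _ _).trans (max_le hle ((hδ z hz).trans hr))

theorem size_smul_eq_pow (hZ : IsKernel π Z) {δ : ℝ≥0} (hδ : ∀ z ∈ Z, z.size ≤ δ)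
    {x : Points H} (hx : δ < x.size) : (π.1 • x).size = x.size ^ Z.card := by
  refine le_antisymm ((hZ.size_smul_le_pow_iff hδ hx.le).2 le_rfl) ?_
  rw [hZ.size_smul, ← Finset.prod_const]
  refine Finset.prod_le_prod' fun z hz => ?_
  have h := Points.size_sub_le z (z - x)
  rw [sub_sub_cancel, Points.size_sub_comm z x] at h
  exact (le_max_iff.1 h).resolve_left ((hδ z hz).trans_lt hx).not_ge

end IsKernel

end Kernel

/-! ### Bases that are orthogonal for a norm -/

section AdaptedBasis

variable {O : Type*} [CommRing O] [IsDomain O] [IsDiscreteValuationRing O] {ϖ : O}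

theorem exists_isUnit_repr {T ι : Type*} [AddCommGroup T] [Module O T] [Fintype ι]
    (hϖ : Irreducible ϖ) (b : Module.Basis ι O T) {x : T} (hx : ¬ ∃ y, x = ϖ • y) :
    ∃ i, IsUnit (b.repr x i) := by
  by_contra! h
  have hdvd : ∀ i, ϖ ∣ b.repr x i := fun i => by
    have h1 := (mem_maximalIdeal _).2 (h i)
    rwa [hϖ.maximalIdeal_eq, Ideal.mem_span_singleton] at h1
  choose c hc using hdvd
  refine hx ⟨∑ i, c i • b i, ?_⟩
  rw [Finset.smul_sum, ← b.sum_repr x]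
  exact Finset.sum_congr rfl fun i _ => by rw [hc, mul_smul]

theorem exists_pow_smul_primitive {T : Type*} [AddCommGroup T] [Module O T] [Module.Free O T]
    [Module.Finite O T] (hϖ : Irreducible ϖ) {x : T} (hx : x ≠ 0) :
    ∃ (l : ℕ) (y : T), x = ϖ ^ l • y ∧ ¬ ∃ z, y = ϖ • z := by
  classical
  let b := Module.Free.chooseBasis O T
  obtain ⟨i, hi⟩ : ∃ i, b.repr x i ≠ 0 := by
    by_contra! h
    exact hx (b.repr.map_eq_zero_iff.1 (Finsupp.ext h))
  have hex : ∃ l, ¬ ∃ y, x = ϖ ^ l • y := by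
    obtain ⟨l, hl⟩ := FiniteMultiplicity.of_not_isUnit hϖ.not_isUnit hi
    refine ⟨l + 1, fun ⟨y, hy⟩ => hl ⟨b.repr y i, ?_⟩⟩
    rw [hy, map_smul, Finsupp.smul_apply, smul_eq_mul]
  obtain ⟨l, hl⟩ : ∃ l, Nat.find hex = l + 1 :=
    Nat.exists_eq_succ_of_ne_zero fun h => Nat.find_spec hex ⟨x, by rw [h, pow_zero, one_smul]⟩
  obtain ⟨y, hy⟩ := not_not.1 (Nat.find_min hex (m := l) (by omega))
  refine ⟨l, y, hy, fun ⟨z, hz⟩ => Nat.find_spec hex ⟨z, ?_⟩⟩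
  rw [hl, pow_succ, mul_smul, ← hz, hy]

/-- Let `r` be the relation `α x ≤ α y` for a norm `α` that takes finitely many values on primitive
vectors of a free module `T`. Then `T` has a basis that is orthogonal for `α`. Its first vector `e`
is a primitive vector of minimal norm: for a linear form `f` with `f e = 1`, all `f x • e` have norm
at most that of `x`, so that one can go on with the kernel of `f`. -/
theorem exists_basis_forall_rel (hϖ : Irreducible ϖ) (m : ℕ) :
    ∀ {T : Type*} [AddCommGroup T] [Module O T] [Module.Free O T] [Module.Finite O T]
      (_ : Module.finrank O T = m) (r : T → T → Prop)
      (_ : ∀ (c : O) x, r (c • x) x) (_ : ∀ x y z, r x z → r y z → r (x + y) z)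
      (_ : ∀ x y, r x y → r (ϖ • x) (ϖ • y)) (_ : ∀ x y z, r x y → r y z → r x z)
      (_ : ∀ P : Set T, P.Nonempty → (∀ x ∈ P, ¬ ∃ y, x = ϖ • y) → ∃ e ∈ P, ∀ y ∈ P, r e y),
      ∃ b : Module.Basis (Fin m) O T,
        ∀ x, ∃ c : Fin m → O, x = ∑ i, c i • b i ∧ ∀ i, r (c i • b i) x := by
  induction m with
  | zero =>
    intro T _ _ _ _ hm r _ _ _ _ _
    have b : Module.Basis (Fin 0) O T := hm ▸ Module.finBasis O T
    refine ⟨b, fun x => ⟨0, ?_, fun i => i.elim0⟩⟩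
    rw [← b.sum_repr x]
    simp
  | succ m ih =>
    intro T _ _ _ _ hm r hsmul hadd hϖr htrans hmin
    have b₀ : Module.Basis (Fin (m + 1)) O T := hm ▸ Module.finBasis O T
    obtain ⟨e, heP, he⟩ := hmin {x | ¬ ∃ y, x = ϖ • y} ⟨b₀ 0, fun ⟨y, hy⟩ => by
      have h := congrArg (fun x => b₀.repr x 0) hy
      simp only [map_smul, Finsupp.smul_apply, smul_eq_mul, Module.Basis.repr_self,
        Finsupp.single_eq_same] at h
      exact hϖ.not_isUnit (IsUnit.of_mul_eq_one _ h.symm)⟩ fun x hx => hx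
    obtain ⟨i, u, hu⟩ := exists_isUnit_repr hϖ b₀ heP
    let f : T →ₗ[O] O := (↑u⁻¹ : O) • b₀.coord i
    have hfe : f e = 1 := by
      simp [f, ← hu]
    let W := LinearMap.ker f
    have hproj : ∀ x, x - f x • e ∈ W := fun x => by
      rw [LinearMap.mem_ker, map_sub, map_smul, hfe, smul_eq_mul, mul_one, sub_self]
    let cons : ∀ {k : ℕ}, Module.Basis (Fin k) O W → Module.Basis (Fin (k + 1)) O T := fun b =>
      Module.Basis.mkFinCons e b
        (fun c x hx h => by
          have := congrArg f h
          rwa [map_add, map_smul, hfe, LinearMap.mem_ker.1 hx, map_zero, add_zero, smul_eq_mul,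
            mul_one] at this)
        fun z => ⟨-f z, by rw [neg_smul, ← sub_eq_add_neg]; exact hproj z⟩
    have hW : Module.finrank O W = m := by
      have h := Module.finrank_eq_card_basis (cons (Module.finBasis O W))
      rw [hm, Fintype.card_fin] at h
      omega
    obtain ⟨b, hb⟩ := ih hW (fun x y => r x y) (fun c x => hsmul c x) (fun x y z => hadd x y z)
      (fun x y => hϖr x y) (fun x y z => htrans x y z) fun P hP hprim => by
        obtain ⟨e', ⟨w, hw, rfl⟩, hmin'⟩ := hmin (Subtype.val '' P) (hP.image _) (by
          rintro _ ⟨x, hx, rfl⟩ ⟨y, hy⟩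
          have hfy : f y = 0 := by
            have h1 : f x.1 = 0 := x.2
            rw [hy, map_smul, smul_eq_mul] at h1
            exact (mul_eq_zero.1 h1).resolve_left hϖ.ne_zero
          exact hprim x hx ⟨⟨y, hfy⟩, Subtype.ext hy⟩)
        exact ⟨w, hw, fun y hy => hmin' _ ⟨y, hy, rfl⟩⟩
    have hfirst : ∀ x, r (f x • e) x := fun x => by
      by_cases hx : x = 0
      · rw [hx, map_zero, zero_smul]
        simpa using hsmul 0 (0 : T)
      · obtain ⟨l, y, rfl, hy⟩ := exists_pow_smul_primitive hϖ hx
        have h1 : ∀ l : ℕ, r (ϖ ^ l • e) (ϖ ^ l • y) := fun l => by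
          induction l with
          | zero => simpa using he y hy
          | succ l ihl =>
            rw [pow_succ', mul_smul, mul_smul]
            exact hϖr _ _ ihl
        rw [map_smul, smul_eq_mul, mul_comm, mul_smul]
        exact htrans _ _ _ (hsmul _ _) (h1 l)
    refine ⟨cons b, fun x => ?_⟩
    obtain ⟨c, hc, hr⟩ := hb ⟨x - f x • e, hproj x⟩
    have hrest : r (x - f x • e) x := by
      rw [sub_eq_add_neg, ← neg_one_smul O]
      refine hadd _ _ _ ?_ (htrans _ _ _ (hsmul _ _) (hfirst x))
      simpa using hsmul 1 x
    have hcons : (cons b : Fin (m + 1) → T) = Fin.cons e fun i => ((b i : W) : T) :=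
      Module.Basis.coe_mkFinCons _ _ _ _
    refine ⟨Fin.cons (f x) c, ?_, fun i => ?_⟩
    · have h := congrArg Subtype.val hc
      simp only [AddSubmonoidClass.coe_finsetSum, SetLike.val_smul] at h
      rw [Fin.sum_univ_succ, hcons]
      simp only [Fin.cons_zero, Fin.cons_succ]
      rw [← h, add_sub_cancel]
    · rw [hcons]
      refine Fin.cases ?_ (fun j => ?_) i
      · exact hfirst x
      · exact htrans _ _ _ (hr j) hrest

end AdaptedBasis

/-! ### Homothety classes and apartments -/

section Vertices

open scoped Pointwise

variable {O F V : Type*} [CommRing O] [Field F] [Algebra O F] [AddCommGroup V] [Module O V]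
  [Module F V] [IsScalarTower O F V]

theorem cls_eq_iff {L M : Submodule O V} : cls F L = cls F M ↔ ∃ a : Fˣ, L = a • M := by
  rw [cls, cls, Quotient.eq, MulAction.orbitRel_apply, MulAction.mem_orbit_iff]
  exact ⟨fun ⟨a, h⟩ => ⟨a, h.symm⟩, fun ⟨a, h⟩ => ⟨a, h.symm⟩⟩

theorem cls_smul (a : Fˣ) (L : Submodule O V) : cls F (a • L) = cls F L :=
  cls_eq_iff.2 ⟨a, rfl⟩

theorem mem_units_smul_iff {a : Fˣ} {L : Submodule O V} {x : V} :
    x ∈ a • L ↔ (↑a⁻¹ : F) • x ∈ L := by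
  constructor
  · rintro ⟨y, hy, rfl⟩
    change (↑a⁻¹ : F) • (a : F) • y ∈ L
    rwa [smul_smul, Units.inv_mul, one_smul]
  · intro h
    refine ⟨_, h, ?_⟩
    change (a : F) • (↑a⁻¹ : F) • x = x
    rw [smul_smul, Units.mul_inv, one_smul]

theorem units_smul_sup (a : Fˣ) (L M : Submodule O V) : a • (L ⊔ M) = a • L ⊔ a • M :=
  Submodule.map_sup L M _

theorem units_smul_le_units_smul_iff {a : Fˣ} {L M : Submodule O V} : a • L ≤ a • M ↔ L ≤ M := by
  refine ⟨fun h x hx => ?_, fun h => Submodule.map_mono h⟩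
  have h1 := h (Submodule.smul_mem_pointwise_smul x a L hx)
  rwa [mem_units_smul_iff, ← Units.smul_def, inv_smul_smul] at h1

variable [IsDomain O] [IsFractionRing O F] {ϖ : O}

variable (F) in
/-- A uniformizer, as a unit of the fraction field. -/
def unif (hϖ : Irreducible ϖ) : Fˣ :=
  Units.mk0 (algebraMap O F ϖ) (by simpa using hϖ.ne_zero)

theorem coe_unif_zpow (hϖ : Irreducible ϖ) (k : ℤ) :
    ((unif F hϖ ^ k : Fˣ) : F) = algebraMap O F ϖ ^ k := by
  rw [Units.val_zpow_eq_zpow_val]; rfl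

theorem smul_eq_unif_smul (hϖ : Irreducible ϖ) (L : Submodule O V) : ϖ • L = unif F hϖ • L := by
  ext x
  constructor <;> rintro ⟨y, hy, rfl⟩ <;> refine ⟨y, hy, ?_⟩
  · exact algebraMap_smul F ϖ y
  · exact (algebraMap_smul F ϖ y).symm

theorem unif_smul_le (hϖ : Irreducible ϖ) (L : Submodule O V) : unif F hϖ • L ≤ L := by
  rw [← smul_eq_unif_smul]
  rintro _ ⟨y, hy, rfl⟩
  exact L.smul_mem ϖ hy

theorem exists_smul_eq_unif_zpow_smul [IsDiscreteValuationRing O] (hϖ : Irreducible ϖ) (a : Fˣ) :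
    ∃ k : ℤ, ∀ L : Submodule O V, a • L = unif F hϖ ^ k • L := by
  obtain ⟨k, u, hu⟩ := IsDiscreteValuationRing.exists_units_eq_smul_zpow_of_irreducible
    hϖ a.ne_zero
  have hstab : ∀ (u : Oˣ) (L : Submodule O V) (x : V), u • x ∈ L → x ∈ L := fun u L x h => by
    have := L.smul_mem (↑u⁻¹ : O) h
    rwa [Units.smul_def, smul_smul, Units.inv_mul, one_smul] at this
  refine ⟨k, fun L => ?_⟩
  have ha : (a : F) = algebraMap O F u * ((unif F hϖ ^ k : Fˣ) : F) := by
    rw [hu, coe_unif_zpow, Units.smul_def, Algebra.smul_def]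
  have hsmul : ∀ y : V, a • y = u • (unif F hϖ ^ k : Fˣ) • y := fun y => by
    rw [Units.smul_def a, ha, mul_smul, algebraMap_smul]
    rfl
  ext x
  constructor
  · rintro ⟨y, hy, rfl⟩
    change a • y ∈ _
    rw [hsmul]
    exact Submodule.smul_mem _ (u : O) ⟨y, hy, rfl⟩
  · rintro ⟨y, hy, rfl⟩
    refine hstab u _ _ ⟨y, hy, ?_⟩
    exact hsmul y

theorem cls_eq_iff_zpow [IsDiscreteValuationRing O] (hϖ : Irreducible ϖ) {L M : Submodule O V} :
    cls F L = cls F M ↔ ∃ k : ℤ, L = unif F hϖ ^ k • M := by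
  refine cls_eq_iff.trans ⟨fun ⟨a, h⟩ => ?_, fun ⟨k, h⟩ => ⟨_, h⟩⟩
  obtain ⟨k, hk⟩ := exists_smul_eq_unif_zpow_smul (V := V) hϖ a
  exact ⟨k, h.trans (hk M)⟩

variable {ι : Type*}

theorem unif_zpow_smul_diagLattice (hϖ : Irreducible ϖ) (e : Module.Basis ι F V) (a : ι → ℤ)
    (k : ℤ) : unif F hϖ ^ k • diagLattice ϖ e a = diagLattice ϖ e fun i => a i + k := by
  change Submodule.map (DistribSMul.toLinearMap O V (unif F hϖ ^ k)) _ = _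
  rw [diagLattice, Submodule.map_span, diagLattice, ← Set.range_comp]
  congr 2
  ext i
  have h0 : algebraMap O F ϖ ≠ 0 := (unif F hϖ).ne_zero
  change (unif F hϖ ^ k : Fˣ) • (algebraMap O F ϖ ^ a i • e i) = _
  rw [Units.smul_def, coe_unif_zpow, smul_smul, ← zpow_add₀ h0, add_comm]

theorem zpow_smul_mem_of_le (hϖ : Irreducible ϖ) {L : Submodule O V} {x : V} {k l : ℤ}
    (hkl : k ≤ l) (h : algebraMap O F ϖ ^ k • x ∈ L) : algebraMap O F ϖ ^ l • x ∈ L := by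
  obtain ⟨j, rfl⟩ := Int.exists_add_of_le hkl
  have h0 : algebraMap O F ϖ ≠ 0 := (unif F hϖ).ne_zero
  rw [add_comm, zpow_add₀ h0, mul_smul, zpow_natCast, ← map_pow, algebraMap_smul]
  exact L.smul_mem _ h

theorem diagLattice_sup (hϖ : Irreducible ϖ) (e : Module.Basis ι F V) (a b : ι → ℤ) :
    diagLattice ϖ e a ⊔ diagLattice ϖ e b = diagLattice ϖ e fun i => min (a i) (b i) := by
  refine le_antisymm (sup_le ?_ ?_) ?_
  · refine Submodule.span_le.2 ?_
    rintro _ ⟨i, rfl⟩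
    exact zpow_smul_mem_of_le hϖ (min_le_left (a i) (b i)) (Submodule.subset_span ⟨i, rfl⟩)
  · refine Submodule.span_le.2 ?_
    rintro _ ⟨i, rfl⟩
    exact zpow_smul_mem_of_le hϖ (min_le_right (a i) (b i)) (Submodule.subset_span ⟨i, rfl⟩)
  · refine Submodule.span_le.2 ?_
    rintro _ ⟨i, rfl⟩
    rcases le_total (a i) (b i) with h | h
    · refine Submodule.mem_sup_left (Submodule.subset_span ⟨i, ?_⟩)
      simp only [min_eq_left h]
    · refine Submodule.mem_sup_right (Submodule.subset_span ⟨i, ?_⟩)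
      simp only [min_eq_right h]

theorem exists_repr_eq_of_mem_diagLattice {e : Module.Basis ι F V} {a : ι → ℤ} {x : V}
    (hx : x ∈ diagLattice ϖ e a) (i : ι) :
    ∃ c : O, e.repr x i = algebraMap O F c * algebraMap O F ϖ ^ a i := by
  classical
  induction hx using Submodule.span_induction with
  | mem x h =>
    obtain ⟨j, rfl⟩ := h
    by_cases hij : j = i
    · subst hij
      exact ⟨1, by simp⟩
    · exact ⟨0, by simp [hij]⟩
  | zero => exact ⟨0, by simp⟩
  | add x y _ _ hx hy =>
    obtain ⟨c, hc⟩ := hx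
    obtain ⟨d, hd⟩ := hy
    exact ⟨c + d, by rw [map_add, Finsupp.add_apply, hc, hd, map_add, add_mul]⟩
  | smul t x _ hx =>
    obtain ⟨c, hc⟩ := hx
    refine ⟨t * c, ?_⟩
    rw [← algebraMap_smul F t x, map_smul, Finsupp.smul_apply, hc, smul_eq_mul, map_mul, mul_assoc]

/-- A submodule that is commensurable with the lattice spanned by a basis and is stable under
the projections to the lines of that basis belongs to the apartment of the basis. -/
theorem exists_eq_diagLattice [IsDiscreteValuationRing O] [Finite ι] (hϖ : Irreducible ϖ)
    (e : Module.Basis ι F V) {L : Submodule O V} (hL : ∀ x ∈ L, ∀ i, e.repr x i • e i ∈ L)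
    {k l : ℤ} (hlow : diagLattice ϖ e (fun _ => k) ≤ L) (hup : L ≤ diagLattice ϖ e (fun _ => l)) :
    ∃ a, L = diagLattice ϖ e a := by
  have h0 : algebraMap O F ϖ ≠ 0 := (unif F hϖ).ne_zero
  have hbdd : ∀ i, ∀ m : ℤ, algebraMap O F ϖ ^ m • e i ∈ L → l ≤ m := fun i m hm => by
    obtain ⟨c, hc⟩ := exists_repr_eq_of_mem_diagLattice (hup hm) i
    rw [map_smul, Finsupp.smul_apply, Module.Basis.repr_self, Finsupp.single_eq_same, smul_eq_mul,
      mul_one] at hc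
    by_contra! hlt
    obtain ⟨j, hj⟩ := Int.exists_add_of_le hlt.le
    have hj0 : j ≠ 0 := by rintro rfl; omega
    have h1 : algebraMap O F (c * ϖ ^ j) = algebraMap O F 1 := by
      rw [map_mul, map_pow, map_one]
      have : algebraMap O F ϖ ^ m * 1 =
          algebraMap O F ϖ ^ m * (algebraMap O F c * algebraMap O F ϖ ^ j) := by
        rw [mul_one, mul_left_comm, ← zpow_natCast, ← zpow_add₀ h0, ← hj]
        exact hc
      exact (mul_left_cancel₀ (zpow_ne_zero _ h0) this).symm
    have h2 := IsFractionRing.injective O F h1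
    exact hϖ.not_isUnit (isUnit_of_dvd_one ((dvd_pow_self ϖ hj0).trans (Dvd.intro_left c h2)))
  have hex : ∀ i, ∃ m : ℤ, algebraMap O F ϖ ^ m • e i ∈ L ∧
      ∀ m' : ℤ, algebraMap O F ϖ ^ m' • e i ∈ L → m ≤ m' := fun i =>
    Int.exists_least_of_bdd ⟨l, hbdd i⟩ ⟨k, hlow (Submodule.subset_span ⟨i, rfl⟩)⟩
  choose a ha hmin using hex
  refine ⟨a, le_antisymm (fun x hx => ?_) (Submodule.span_le.2 ?_)⟩
  · cases nonempty_fintype ι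
    rw [← e.sum_repr x]
    refine Submodule.sum_mem _ fun i _ => ?_
    have hxi := hL x hx i
    by_cases hz : e.repr x i = 0
    · rw [hz, zero_smul]
      exact zero_mem _
    · obtain ⟨m, u, hu⟩ :=
        IsDiscreteValuationRing.exists_units_eq_smul_zpow_of_irreducible hϖ hz
      rw [hu, Units.smul_def, smul_assoc] at hxi ⊢
      have h1 : algebraMap O F ϖ ^ m • e i ∈ L := by
        have := L.smul_mem (↑u⁻¹ : O) hxi
        rwa [smul_smul, Units.inv_mul, one_smul] at this
      exact Submodule.smul_mem _ _
        (zpow_smul_mem_of_le hϖ (hmin i m h1) (Submodule.subset_span ⟨i, rfl⟩))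
  · rintro _ ⟨i, rfl⟩
    exact ha i

theorem exists_eq_diagLattice_of_cls_eq [IsDiscreteValuationRing O] (hϖ : Irreducible ϖ)
    {e : Module.Basis ι F V} {L : Submodule O V} {a : ι → ℤ}
    (h : cls F L = cls F (diagLattice ϖ e a)) : ∃ k : ℤ, L = diagLattice ϖ e fun i => a i + k := by
  obtain ⟨k, hk⟩ := (cls_eq_iff_zpow hϖ).1 h
  exact ⟨k, by rw [hk, unif_zpow_smul_diagLattice]⟩

/-- An enclosure that contains the classes of `L` and `M` contains the class of `L + M`. -/
theorem cls_sup_mem_enclos [IsDiscreteValuationRing O] (hϖ : Irreducible ϖ)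
    {e : Module.Basis ι F V} {L M : Submodule O V} {S : Set (HomothetyClass O F V)}
    (hS : S ⊆ apartment ϖ e) (hL : cls F L ∈ S) (hM : cls F M ∈ S) :
    cls F (L ⊔ M) ∈ enclos ϖ e S := by
  refine ⟨?_, fun i j k _ hsub => ?_⟩
  · obtain ⟨a, ha⟩ := hS hL
    obtain ⟨b, hb⟩ := hS hM
    obtain ⟨k, rfl⟩ := exists_eq_diagLattice_of_cls_eq hϖ ha.symm
    obtain ⟨l, rfl⟩ := exists_eq_diagLattice_of_cls_eq hϖ hb.symm
    rw [diagLattice_sup hϖ]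
    exact ⟨_, rfl⟩
  · obtain ⟨a, ha, hak⟩ := hsub hL
    obtain ⟨b, hb, hbk⟩ := hsub hM
    obtain ⟨m, rfl⟩ := exists_eq_diagLattice_of_cls_eq hϖ ha
    obtain ⟨l, rfl⟩ := exists_eq_diagLattice_of_cls_eq hϖ hb
    rw [diagLattice_sup hϖ]
    exact ⟨_, rfl, by omega⟩

end Vertices

/-! ### Shifts in the rational Tate module -/

section TateModule

open scoped Pointwise

variable {F K : Type*} [NontriviallyNormedField F] [IsUltrametricDist F]
  [NontriviallyNormedField K] [IsUltrametricDist K] [NormedAlgebra F K]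
  {H : FormalModule (Valued.integer F) (Valued.integer K)} {π : Uniformizer F} [CompleteSpace K]

theorem smul_tateV_apply (x : tateV H π) (i : ℤ) : (π.1 • x).1 i = x.1 (i - 1) := by
  have h := x.2.1 (i - 1)
  rwa [sub_add_cancel] at h

theorem unif_smul_apply (x : tateV H π) (i : ℤ) : (unif F π.2 • x).1 i = x.1 (i - 1) := by
  rw [← smul_tateV_apply]
  exact congrArg (fun y : tateV H π => y.1 i) (algebraMap_smul F π.1 x)

theorem unif_zpow_smul_apply (k : ℤ) (x : tateV H π) (i : ℤ) :
    (unif F π.2 ^ k • x).1 i = x.1 (i - k) := by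
  induction k generalizing i with
  | zero => rw [zpow_zero, one_smul, sub_zero]
  | succ k ih =>
    rw [zpow_add_one, mul_comm, mul_smul, unif_smul_apply, ih]
    exact congrArg x.1 (by ring)
  | pred k ih =>
    have h : unif F π.2 • (unif F π.2 ^ (-(k : ℤ) - 1) • x) = unif F π.2 ^ (-(k : ℤ)) • x := by
      rw [smul_smul, ← zpow_one_add]
      congr 2
      omega
    have h2 := unif_smul_apply (unif F π.2 ^ (-(k : ℤ) - 1) • x) (i + 1)
    rw [h, ih, add_sub_cancel_right] at h2
    rw [← h2]
    exact congrArg x.1 (by ring)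

theorem mem_unif_zpow_smul_iff {k : ℤ} {L : Submodule (Valued.integer F) (tateV H π)}
    {x : tateV H π} : x ∈ unif F π.2 ^ k • L ↔ unif F π.2 ^ (-k) • x ∈ L := by
  rw [mem_units_smul_iff, zpow_neg]
  rfl

theorem mem_unif_smul_iff {L : Submodule (Valued.integer F) (tateV H π)}
    {x : tateV H π} : x ∈ unif F π.2 • L ↔ (unif F π.2)⁻¹ • x ∈ L :=
  mem_units_smul_iff

theorem unif_inv_smul_apply (x : tateV H π) (i : ℤ) :
    ((unif F π.2)⁻¹ • x).1 i = x.1 (i + 1) := by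
  rw [← zpow_neg_one, unif_zpow_smul_apply, sub_neg_eq_add]

theorem exists_pow_smul_apply_eq_zero (x : tateV H π) (i : ℤ) : ∃ k : ℕ, π.1 ^ k • x.1 i = 0 := by
  obtain ⟨N, hN⟩ := x.2.2
  refine ⟨(i - N).toNat, ?_⟩
  have h := tateV_pow_smul x (i - N).toNat (i - (i - N).toNat)
  rw [sub_add_cancel] at h
  rw [h]
  exact hN _ (by omega)

theorem eq_zero_of_le {x : tateV H π} {i j : ℤ} (hij : i ≤ j) (h : x.1 j = 0) : x.1 i = 0 := by
  obtain ⟨k, rfl⟩ := Int.exists_add_of_le hij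
  rw [← tateV_pow_smul x k i, h, smul_zero]

theorem mem_tateT_iff {x : tateV H π} : x ∈ tateT H π ↔ x.1 0 = 0 :=
  ⟨fun h => h 0 le_rfl, fun h _ hi => eq_zero_of_le hi h⟩

/-- Every torsion point is the component of index `0` of an element of the rational Tate module. -/
theorem exists_tateV_apply_zero_eq (hsurj : ∀ y : Points H, ∃ x : Points H, π.1 • x = y)
    {k : ℕ} {y : Points H} (hy : π.1 ^ k • y = 0) : ∃ x : tateV H π, x.1 0 = y := by
  choose g hg using hsurj
  let f : ℤ → Points H
    | Int.ofNat j => g^[j] y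
    | Int.negSucc j => π.1 ^ (j + 1) • y
  refine ⟨⟨f, ?_, -k, fun i hi => ?_⟩, rfl⟩
  · rintro (j | _ | j)
    · change π.1 • g^[j + 1] y = g^[j] y
      rw [Function.iterate_succ_apply', hg]
    · change π.1 • y = π.1 ^ 1 • y
      rw [pow_one]
    · change π.1 • π.1 ^ (j + 1) • y = π.1 ^ (j + 1 + 1) • y
      rw [pow_succ' _ (j + 1), mul_smul]
  · rcases i with j | j
    · obtain rfl : k = 0 := by simp at hi; omega
      obtain rfl : j = 0 := by simp at hi; omega
      change y = 0
      simpa using hy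
    · change π.1 ^ (j + 1) • y = 0
      obtain ⟨l, hl⟩ := Nat.exists_eq_add_of_le (show k ≤ j + 1 by omega)
      rw [hl, add_comm, pow_add, mul_smul, hy, smul_zero]

/-! ### The filtration indexed by absolute values -/

variable (H π) in
/-- The lower ramification filtration, indexed by the bound `r` on the absolute value of the
component of index `0` instead of its valuation. -/
def normFil (r : ℝ≥0) : Submodule (Valued.integer F) (tateV H π) where
  carrier := {x | (x.1 0).size ≤ r}
  add_mem' := fun {x y} hx hy => (Points.size_add_le (x.1 0) (y.1 0)).trans (max_le hx hy)
  zero_mem' := by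
    change (0 : Points H).size ≤ r
    rw [Points.size_zero]
    exact bot_le
  smul_mem' := fun c x hx => le_trans (Points.size_smul_le c (x.1 0)) hx

theorem mem_normFil {r : ℝ≥0} {x : tateV H π} : x ∈ normFil H π r ↔ (x.1 0).size ≤ r := Iff.rfl

theorem normFil_mono : Monotone (normFil H π) := fun _ _ h _ hx => le_trans hx h

theorem normFil_zero : normFil H π 0 = tateT H π := by
  ext x
  rw [mem_normFil, mem_tateT_iff, ← Points.size_eq_zero, le_zero_iff]

theorem tateT_le_normFil (r : ℝ≥0) : tateT H π ≤ normFil H π r :=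
  normFil_zero (H := H) (π := π) ▸ normFil_mono bot_le

theorem fil_top : fil H π ⊤ = tateT H π := by
  ext x
  rw [mem_tateT_iff]
  change ⊤ ≤ val π (x.1 0).coord ↔ _
  rw [top_le_iff, val]
  split_ifs with h
  · exact ⟨fun _ => Points.ext h, fun _ => rfl⟩
  · exact ⟨fun h' => absurd h' (EReal.coe_ne_top _), fun h' => absurd (h' ▸ rfl) h⟩

theorem coe_le_val_iff {t : ℝ} {z : Valued.integer K} :
    (t : EReal) ≤ val π z ↔ ‖z‖₊ ≤ ‖π.1‖₊ ^ t := by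
  have h0 : 0 < ‖π.1‖ := norm_uniformizer_pos π
  have h1 : ‖π.1‖ < 1 := norm_uniformizer_lt_one π
  rw [val]
  split_ifs with h
  · simp [h]
  · have hz : 0 < ‖z‖ := norm_pos_iff.2 h
    rw [EReal.coe_le_coe_iff, le_div_iff_of_neg (Real.log_neg h0 h1), ← Real.log_rpow h0,
      Real.log_le_log_iff hz (Real.rpow_pos_of_pos h0 t), ← NNReal.coe_le_coe, NNReal.coe_rpow]
    rfl

theorem fil_coe (t : ℝ) : fil H π t = normFil H π (‖π.1‖₊ ^ t) := by
  ext x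
  exact coe_le_val_iff

theorem exists_normFil_eq {t : EReal} (ht : 0 < t) : ∃ r < 1, fil H π t = normFil H π r := by
  induction t with
  | bot => simp at ht
  | coe t =>
    exact ⟨_, NNReal.rpow_lt_one (norm_uniformizer_lt_one π) (EReal.coe_pos.1 ht), fil_coe t⟩
  | top => exact ⟨0, one_pos, by rw [fil_top, normFil_zero]⟩

theorem exists_rpow_eq {r : ℝ≥0} (hr : 0 < r) (π : Uniformizer F) :
    ∃ t : ℝ, ‖π.1‖₊ ^ t = r := by
  have h0 := norm_uniformizer_pos π
  have h1 := norm_uniformizer_lt_one π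
  refine ⟨Real.log r / Real.log ‖π.1‖₊, NNReal.eq ?_⟩
  rw [NNReal.coe_rpow, Real.rpow_def_of_pos (NNReal.coe_pos.2 h0), mul_div_cancel₀,
    Real.exp_log (NNReal.coe_pos.2 hr)]
  exact (Real.log_neg (NNReal.coe_pos.2 h0) (by exact_mod_cast h1)).ne

theorem ramificationVertices_eq :
    ramificationVertices H π = {x | ∃ r < 1, x = cls F (normFil H π r)} := by
  ext x
  constructor
  · rintro ⟨t, ht, rfl⟩
    obtain ⟨r, hr, h⟩ := exists_normFil_eq (H := H) (π := π) ht
    exact ⟨r, hr, by rw [h]⟩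
  · rintro ⟨r, hr, rfl⟩
    rcases eq_or_ne r 0 with rfl | hr0
    · exact ⟨⊤, EReal.coe_lt_top 0, by rw [fil_top, normFil_zero]⟩
    · obtain ⟨t, rfl⟩ := exists_rpow_eq (pos_iff_ne_zero.2 hr0) π
      refine ⟨t, EReal.coe_pos.2 ?_, by rw [fil_coe]⟩
      by_contra! ht
      exact (NNReal.one_le_rpow_of_pos_of_le_one_of_nonpos (norm_uniformizer_pos π)
        (norm_uniformizer_lt_one π).le ht).not_gt hr

theorem smallVertices_eq (ε : ℝ) :
    smallVertices H π ε = {x | ∃ r, ‖π.1‖₊ ^ ε ≤ r ∧ r < 1 ∧ x = cls F (normFil H π r)} := by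
  have h0 := norm_uniformizer_pos π
  have h1 := norm_uniformizer_lt_one π
  ext x
  constructor
  · rintro ⟨t, ht, hε, rfl⟩
    exact ⟨_, NNReal.rpow_le_rpow_of_exponent_ge h0 h1.le hε, NNReal.rpow_lt_one h1 ht,
      by rw [fil_coe]⟩
  · rintro ⟨r, hr, hr1, rfl⟩
    obtain ⟨t, rfl⟩ := exists_rpow_eq ((NNReal.rpow_pos h0).trans_le hr) π
    exact ⟨t, by
      by_contra! ht
      exact (NNReal.one_le_rpow_of_pos_of_le_one_of_nonpos h0 h1.le ht).not_gt hr1, by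
      by_contra! ht
      exact (NNReal.rpow_lt_rpow_of_exponent_gt h0 h1 ht).not_ge hr, by rw [fil_coe]⟩

theorem isSmall_iff (hsurj : ∀ y : Points H, ∃ x : Points H, π.1 • x = y)
    {Z : Finset (Points H)} (hZ : IsKernel π Z) {ε : ℝ} :
    IsSmall H π ε ↔ ∀ z ∈ Z, z.size ≤ ‖π.1‖₊ ^ ε := by
  constructor
  · intro h z hz
    have hz0 := (hZ.mem_iff z).1 hz
    obtain ⟨x, rfl⟩ := exists_tateV_apply_zero_eq hsurj (k := 1) (by rwa [pow_one])
    refine coe_le_val_iff.1 (h x ?_)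
    rw [fil_top, mem_tateT_iff]
    exact hz0
  · intro h x hx
    rw [fil_top, mem_tateT_iff] at hx
    exact coe_le_val_iff.2 (h _ ((hZ.mem_iff _).2 hx))

namespace IsKernel

variable {Z : Finset (Points H)}

/-- Multiplication by the uniformizer maps each step of the filtration onto a step, up to elements
of the Tate module. -/
theorem unif_smul_normFil_sup (hZ : IsKernel π Z)
    (hsurj : ∀ y : Points H, ∃ x : Points H, π.1 • x = y) (r : ℝ≥0) :
    unif F π.2 • normFil H π r ⊔ tateT H π = normFil H π (renumber Z r) := by
  refine le_antisymm (sup_le ?_ (tateT_le_normFil _)) fun x hx => ?_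
  · intro x hx
    rw [mem_unif_smul_iff, mem_normFil, unif_inv_smul_apply] at hx
    rw [mem_normFil, ← x.2.1 0]
    exact hZ.size_smul_le hx
  · rw [mem_normFil, ← x.2.1 0] at hx
    obtain ⟨z, hz, hle⟩ := hZ.exists_sub_size_le hx
    have hz0 := (hZ.mem_iff z).1 hz
    obtain ⟨t, ht⟩ := exists_tateV_apply_zero_eq hsurj (k := 1) (y := z) (by rwa [pow_one])
    rw [← sub_add_cancel x (π.1 • t)]
    refine Submodule.add_mem_sup ?_ ?_
    · rw [mem_unif_smul_iff, mem_normFil, unif_inv_smul_apply]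
      change (x.1 (0 + 1) - (π.1 • t).1 (0 + 1)).size ≤ r
      rwa [smul_tateV_apply, add_sub_cancel_right, ht]
    · rw [mem_tateT_iff]
      change π.1 • t.1 0 = 0
      rw [ht, hz0]

theorem unif_pow_smul_normFil_sup (hZ : IsKernel π Z)
    (hsurj : ∀ y : Points H, ∃ x : Points H, π.1 • x = y) (r : ℝ≥0) (k : ℕ) :
    unif F π.2 ^ k • normFil H π r ⊔ tateT H π = normFil H π ((renumber Z)^[k] r) := by
  induction k with
  | zero => rw [pow_zero, one_smul, sup_eq_left.2 (tateT_le_normFil r), Function.iterate_zero, id]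
  | succ k ih =>
    rw [Function.iterate_succ_apply', ← hZ.unif_smul_normFil_sup hsurj, ← ih, units_smul_sup,
      sup_assoc, sup_eq_right.2 (unif_smul_le π.2 (tateT H π)), pow_succ', mul_smul]

/-- In the range where the filtration is close to the whole space, multiplication by the uniformizer
renumbers it by a power. -/
theorem unif_smul_normFil (hZ : IsKernel π Z) {δ r : ℝ≥0} (hδ : ∀ z ∈ Z, z.size ≤ δ)
    (hr : δ ≤ r) : unif F π.2 • normFil H π r = normFil H π (r ^ Z.card) := by
  ext x
  rw [mem_unif_smul_iff, mem_normFil, mem_normFil, unif_inv_smul_apply, ← x.2.1 0,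
    hZ.size_smul_le_pow_iff hδ hr]

theorem exists_normFil_le (hZ : IsKernel π Z) (hcard : 1 < Z.card) {r : ℝ≥0} (hr : r < 1) :
    ∃ m : ℕ, normFil H π r ≤ unif F π.2 ^ (-(m : ℤ)) • tateT H π := by
  obtain ⟨m, hm⟩ := hZ.exists_pow_smul_eq_zero hcard hr
  refine ⟨m, fun x hx => ?_⟩
  obtain ⟨k, hk⟩ := exists_pow_smul_apply_eq_zero x 0
  have h := hm k _ hk hx
  rw [mem_unif_zpow_smul_iff, neg_neg, mem_tateT_iff, unif_zpow_smul_apply,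
    ← tateV_pow_smul x m, sub_add_cancel, h]

end IsKernel

end TateModule

/-! ### The lattice `T_p(H)` and its rank -/

theorem isPrecomplete_pi {R ι : Type*} [CommRing R] [Finite ι] (a : R)
    [IsPrecomplete (Ideal.span {a}) R] : IsPrecomplete (Ideal.span {a}) (ι → R) where
  prec' f hf := by
    have hmem : ∀ (k : ℕ) (x : ι → R), x ∈ (Ideal.span {a} ^ k • ⊤ : Submodule R (ι → R)) ↔
        ∀ i, x i ∈ (Ideal.span {a} ^ k • ⊤ : Submodule R R) := fun k x => by
      simp only [Ideal.span_singleton_pow, Submodule.ideal_span_singleton_smul,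
        Submodule.mem_smul_pointwise_iff_exists, Submodule.mem_top, true_and]
      constructor
      · rintro ⟨y, rfl⟩ i
        exact ⟨y i, rfl⟩
      · intro h
        choose y hy using h
        exact ⟨y, funext hy⟩
    have h : ∀ i, ∃ L, ∀ k, f k i ≡ L [SMOD (Ideal.span {a} ^ k • ⊤ : Submodule R R)] := fun i =>
      IsPrecomplete.prec' (fun k => f k i) fun {m n} hmn => by
        rw [SModEq.sub_mem]
        have := hf hmn
        rw [SModEq.sub_mem, hmem] at this
        exact this i
    choose L hL using h
    refine ⟨L, fun k => ?_⟩
    rw [SModEq.sub_mem, hmem]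
    intro i
    have := hL i k
    rwa [SModEq.sub_mem] at this

/-- A form of Nakayama's lemma over a complete ring: a separated module with finite reduction is
finitely generated. -/
theorem finite_of_forall_exists_add_smul {R N ι : Type*} [CommRing R] [AddCommGroup N] [Module R N]
    [Finite ι] (a : R) [IsPrecomplete (Ideal.span {a}) R] [IsHausdorff (Ideal.span {a}) N]
    (t : ι → N) (h : ∀ x, ∃ i y, x = t i + a • y) : Module.Finite R N := by
  classical
  cases nonempty_fintype ι
  have _ := isPrecomplete_pi (ι := ι) a
  refine Module.Finite.of_surjective (Fintype.linearCombination R t)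
    (surjective_of_mkQ_comp_surjective (I := Ideal.span {a}) fun y => ?_)
  obtain ⟨x, rfl⟩ := Submodule.mkQ_surjective _ y
  obtain ⟨i, y, rfl⟩ := h x
  refine ⟨Pi.single i 1, ?_⟩
  rw [LinearMap.comp_apply, Fintype.linearCombination_apply_single, one_smul, map_add, eq_comm,
    add_eq_left, Submodule.mkQ_apply, Submodule.Quotient.mk_eq_zero,
    Submodule.ideal_span_singleton_smul, Submodule.mem_smul_pointwise_iff_exists]
  exact ⟨y, trivial, rfl⟩

section TateLattice

open scoped Pointwise

variable {F K : Type*} [NontriviallyNormedField F] [IsUltrametricDist F]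
  [NontriviallyNormedField K] [IsUltrametricDist K] [NormedAlgebra F K]
  {H : FormalModule (Valued.integer F) (Valued.integer K)} {π : Uniformizer F} [CompleteSpace K]
  {Z : Finset (Points H)}

theorem exists_eq_smul_tateT_iff {x : tateT H π} : (∃ y, x = π.1 • y) ↔ x.1.1 1 = 0 := by
  constructor
  · rintro ⟨y, rfl⟩
    change (π.1 • y.1).1 1 = 0
    rw [smul_tateV_apply]
    exact y.2 _ (by norm_num)
  · intro h
    refine ⟨⟨(unif F π.2)⁻¹ • x.1, ?_⟩, Subtype.ext ?_⟩
    · rw [mem_tateT_iff, unif_inv_smul_apply]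
      exact h
    · change x.1 = π.1 • ((unif F π.2)⁻¹ • x.1)
      ext1
      funext i
      rw [smul_tateV_apply, unif_inv_smul_apply, sub_add_cancel]

theorem isHausdorff_tateT : IsHausdorff (Ideal.span {π.1}) (tateT H π) where
  haus' x hx := by
    have h : ∀ k : ℕ, x.1.1 k = 0 := fun k => by
      have h1 := hx k
      rw [SModEq.zero, Ideal.span_singleton_pow, Submodule.ideal_span_singleton_smul,
        Submodule.mem_smul_pointwise_iff_exists] at h1
      obtain ⟨y, -, rfl⟩ := h1
      have h2 := tateV_pow_smul y.1 k 0
      rw [zero_add, y.2 0 le_rfl] at h2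
      exact h2
    refine Subtype.ext (Subtype.ext (funext fun i => ?_))
    exact eq_zero_of_le (Int.self_le_toNat i) (h _)

theorem exists_tateT_apply_one_eq (hsurj : ∀ y : Points H, ∃ x : Points H, π.1 • x = y)
    {z : Points H} (hz : π.1 • z = 0) : ∃ x : tateT H π, x.1.1 1 = z := by
  obtain ⟨x, rfl⟩ := exists_tateV_apply_zero_eq hsurj (k := 1) (by rwa [pow_one])
  exact ⟨⟨π.1 • x, mem_tateT_iff.2 hz⟩, smul_tateV_apply x 1⟩

/-- The Tate module is finitely generated because it is `π`-adically separated and its reduction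
modulo `π` is the kernel of `[π]`, which is finite. -/
theorem IsKernel.finite_tateT (hZ : IsKernel π Z) [CompleteSpace F]
    (hsurj : ∀ y : Points H, ∃ x : Points H, π.1 • x = y) :
    Module.Finite (Valued.integer F) (tateT H π) := by
  classical
  have _ := isAdicComplete_span (K := F) (c := π.1) (norm_uniformizer_lt_one π)
  have _ := isHausdorff_tateT (H := H) (π := π)
  choose t ht using fun z : Z => exists_tateT_apply_one_eq hsurj ((hZ.mem_iff z).1 z.2)
  refine finite_of_forall_exists_add_smul π.1 t fun x => ?_
  have hx : x.1.1 1 ∈ Z := by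
    rw [hZ.mem_iff]
    have h1 := x.1.2.1 0
    rw [zero_add] at h1
    rw [h1]
    exact x.2 0 le_rfl
  obtain ⟨y, hy⟩ := exists_eq_smul_tateT_iff.2
    (show (x - t ⟨_, hx⟩).1.1 1 = 0 from by
      change x.1.1 1 - (t ⟨_, hx⟩).1.1 1 = 0
      rw [ht, sub_self])
  exact ⟨⟨_, hx⟩, y, eq_add_of_sub_eq' hy⟩

theorem isLattice_tateT [Module.Finite (Valued.integer F) (tateT H π)] :
    (tateT H π).IsLattice F where
  fg := Module.Finite.iff_fg.1 inferInstance
  span_eq_top := by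
    refine eq_top_iff.2 fun x _ => ?_
    obtain ⟨k, hk⟩ := exists_pow_smul_apply_eq_zero x 0
    have h : unif F π.2 ^ (k : ℤ) • x ∈ tateT H π := by
      rw [mem_tateT_iff, unif_zpow_smul_apply, ← tateV_pow_smul x k, sub_add_cancel, hk]
    have h1 := Submodule.smul_mem (Submodule.span F (tateT H π : Set (tateV H π)))
      ((unif F π.2 ^ (k : ℤ))⁻¹ : Fˣ) (Submodule.subset_span h)
    rwa [← Units.smul_def, inv_smul_smul] at h1

theorem IsKernel.isLattice_normFil (hZ : IsKernel π Z) (hcard : 1 < Z.card)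
    [IsDiscreteValuationRing (Valued.integer F)]
    [Module.Finite (Valued.integer F) (tateT H π)] {r : ℝ≥0} (hr : r < 1) :
    (normFil H π r).IsLattice F := by
  have _ := isLattice_tateT (H := H) (π := π)
  obtain ⟨m, hm⟩ := hZ.exists_normFil_le hcard hr
  have hfg : (unif F π.2 ^ (-(m : ℤ)) • tateT H π).FG := Submodule.IsLattice.fg (A := F)
  have _ : IsNoetherian (Valued.integer F) ↥(unif F π.2 ^ (-(m : ℤ)) • tateT H π) :=
    isNoetherian_of_fg_of_noetherian _ hfg
  refine Submodule.IsLattice.of_le_of_isLattice_of_fg F (tateT_le_normFil r) ?_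
  have h := (IsNoetherian.noetherian ((normFil H π r).comap
    (unif F π.2 ^ (-(m : ℤ)) • tateT H π).subtype)).map
      (unif F π.2 ^ (-(m : ℤ)) • tateT H π).subtype
  rwa [Submodule.map_comap_subtype, inf_eq_right.2 hm] at h

/-- The rank of the Tate module is the height. -/
theorem IsKernel.finrank_tateT (hZ : IsKernel π Z) [IsDiscreteValuationRing (Valued.integer F)]
    [Module.Finite (Valued.integer F) (tateT H π)] [Module.Free (Valued.integer F) (tateT H π)]
    (hsurj : ∀ y : Points H, ∃ x : Points H, π.1 • x = y) {n : ℕ}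
    (hcard : Z.card = Nat.card (ResidueField (Valued.integer F)) ^ n) (h1 : 1 < Z.card) :
    Module.finrank (Valued.integer F) (tateT H π) = n := by
  set m := Module.finrank (Valued.integer F) (tateT H π) with hm
  let b := Module.finBasis (Valued.integer F) (tateT H π)
  -- The component of index `1` identifies `T_p(H) / π T_p(H)` with the kernel of `[π]`.
  let g : tateT H π →ₗ[Valued.integer F] Points H :=
    { toFun := fun x => x.1.1 1
      map_add' := fun x y => rfl
      map_smul' := fun c x => rfl }
  let G : (Fin m → Valued.integer F) →ₗ[Valued.integer F] Points H :=
    g ∘ₗ b.equivFun.symm.toLinearMap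
  have hker : LinearMap.ker G =
      Submodule.pi Set.univ fun _ => maximalIdeal (Valued.integer F) := by
    ext c
    have h2 : G c = 0 ↔ ∃ y, b.equivFun.symm c = π.1 • y := exists_eq_smul_tateT_iff.symm
    rw [LinearMap.mem_ker, h2, Submodule.mem_pi, π.2.maximalIdeal_eq]
    simp only [Set.mem_univ, forall_const, Ideal.mem_span_singleton]
    constructor
    · rintro ⟨y, hy⟩ i
      refine ⟨b.equivFun y i, ?_⟩
      rw [LinearEquiv.symm_apply_eq, map_smul] at hy
      rw [hy]
      rfl
    · intro h
      choose d hd using h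
      refine ⟨b.equivFun.symm d, ?_⟩
      rw [← map_smul]
      exact congrArg _ (funext hd)
  have hrange : (LinearMap.range G : Set (Points H)) = Z := by
    ext z
    rw [SetLike.mem_coe, LinearMap.range_comp_of_range_eq_top _ (LinearEquiv.range _),
      LinearMap.mem_range, Finset.mem_coe, hZ.mem_iff]
    constructor
    · rintro ⟨x, rfl⟩
      have h2 := x.1.2.1 0
      rw [zero_add] at h2
      exact h2.trans (x.2 0 le_rfl)
    · intro hz
      exact exists_tateT_apply_one_eq hsurj hz
  have hcount : Nat.card (ResidueField (Valued.integer F)) ^ m = Z.card := by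
    have e1 := Nat.card_congr G.quotKerEquivRange.toEquiv
    rw [hker] at e1
    have e2 := Nat.card_congr
      (Submodule.quotientPi fun _ : Fin m => maximalIdeal (Valued.integer F)).toEquiv
    rw [Nat.card_pi, Finset.prod_const, Finset.card_univ, Fintype.card_fin] at e2
    have e3 : Nat.card (LinearMap.range G) = Z.card := by
      rw [← SetLike.coe_sort_coe, hrange]
      simp
    rw [← e3, ← e1, e2]
    rfl
  have hq : 1 < Nat.card (ResidueField (Valued.integer F)) := by
    by_contra! hle
    exact (hcard ▸ h1).not_ge (pow_le_one₀ (Nat.zero_le _) hle)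
  exact Nat.pow_right_injective hq (hcount.trans hcard)

end TateLattice

/-! ### A common apartment -/

section Apartment

open scoped Pointwise

variable {F K : Type*} [NontriviallyNormedField F] [IsUltrametricDist F]
  [NontriviallyNormedField K] [IsUltrametricDist K] [NormedAlgebra F K]
  {H : FormalModule (Valued.integer F) (Valued.integer K)} {π : Uniformizer F} [CompleteSpace K]
  {Z : Finset (Points H)} {δ : ℝ≥0}

namespace IsKernel

theorem finite_torsion (hZ : IsKernel π Z) (k : ℕ) : {x : Points H | π.1 ^ k • x = 0}.Finite := by
  induction k with
  | zero => simp
  | succ k ih =>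
    have h : {x : Points H | π.1 ^ (k + 1) • x = 0} =
        (fun x => π.1 • x) ⁻¹' {x : Points H | π.1 ^ k • x = 0} := by
      ext x
      simp only [Set.mem_ofPred_eq, Set.mem_preimage, pow_succ, mul_smul]
    rw [h]
    refine ih.preimage' fun y _ => ?_
    by_cases hy : ∃ x₀ : Points H, π.1 • x₀ = y
    · obtain ⟨x₀, rfl⟩ := hy
      refine (Z.finite_toSet.image fun z => z + x₀).subset fun x hx => ?_
      refine ⟨x - x₀, ?_, sub_add_cancel x x₀⟩
      rw [Finset.mem_coe, hZ.mem_iff, smul_sub, sub_eq_zero]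
      exact hx
    · exact (Set.finite_empty).subset fun x hx => hy ⟨x, hx⟩

/-- Every large step of the filtration is `π` times another one, whose index is the root of order
`Q` of the given index, where `Q` is the order of the kernel. -/
theorem exists_unif_smul_normFil_eq (hZ : IsKernel π Z) (hδ : ∀ z ∈ Z, z.size ≤ δ)
    (hcard : 1 < Z.card) {r : ℝ≥0} (hr : δ ≤ r) (hr1 : r < 1) :
    ∃ s, δ ≤ s ∧ s < 1 ∧ s ^ Z.card = r ∧ unif F π.2 • normFil H π s = normFil H π r := by
  have hs : (r ^ (Z.card : ℝ)⁻¹) ^ Z.card = r := NNReal.rpow_inv_natCast_pow r (by omega)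
  set s := r ^ (Z.card : ℝ)⁻¹
  have hs1 : s < 1 := by
    by_contra! h
    exact (hs ▸ one_le_pow₀ h).not_gt hr1
  have hδs : δ ≤ s := hr.trans (hs ▸ pow_le_of_le_one bot_le hs1.le (by omega))
  exact ⟨s, hδs, hs1, hs, by rw [hZ.unif_smul_normFil hδ hδs, hs]⟩

theorem exists_unif_pow_smul_normFil_eq (hZ : IsKernel π Z) (hδ : ∀ z ∈ Z, z.size ≤ δ)
    (hcard : 1 < Z.card) (k : ℕ) {r : ℝ≥0} (hr : δ ≤ r) (hr1 : r < 1) :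
    ∃ s, δ ≤ s ∧ s < 1 ∧ unif F π.2 ^ (k : ℤ) • normFil H π s = normFil H π r := by
  induction k with
  | zero => exact ⟨r, hr, hr1, by simp⟩
  | succ k ih =>
    obtain ⟨s, hs, hs1, h⟩ := ih
    obtain ⟨t, ht, ht1, -, h'⟩ := hZ.exists_unif_smul_normFil_eq hδ hcard hs hs1
    exact ⟨t, ht, ht1, by rw [Nat.cast_succ, zpow_add_one, mul_smul, h', h]⟩

theorem size_apply_eq_pow (hZ : IsKernel π Z) (hδ : ∀ z ∈ Z, z.size ≤ δ) {x : tateV H π} {i : ℤ}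
    (h : δ < (x.1 (i + 1)).size) : (x.1 i).size = (x.1 (i + 1)).size ^ Z.card := by
  rw [← x.2.1 i, hZ.size_smul_eq_pow hδ h]

/-- In a set of elements of the Tate module that are not divisible by `π` there is one whose
components of large index are of minimal size: these sizes are determined by that of a single
component, which is a point of a fixed finite torsion subgroup. -/
theorem exists_eventually_size_le (hZ : IsKernel π Z) (hδ : ∀ z ∈ Z, z.size ≤ δ) (hδ1 : δ < 1)
    (hcard : 1 < Z.card) {P : Set (tateT H π)} (hP : P.Nonempty)
    (hprim : ∀ x ∈ P, ¬ ∃ y, x = π.1 • y) :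
    ∃ e ∈ P, ∀ y ∈ P, ∀ᶠ k : ℕ in Filter.atTop, (e.1.1 k).size ≤ (y.1.1 k).size := by
  obtain ⟨m, hm⟩ := hZ.exists_pow_smul_eq_zero hcard hδ1
  have hlarge : ∀ x ∈ P, ∀ k : ℕ, m + 1 ≤ k → δ < (x.1.1 k).size := fun x hx k hk => by
    by_contra! hle
    obtain ⟨j, hj⟩ := exists_pow_smul_apply_eq_zero x.1 k
    have h1 := hm j _ hj hle
    have h2 := tateV_pow_smul x.1 m (k - m)
    rw [sub_add_cancel, h1] at h2
    exact hprim x hx (exists_eq_smul_tateT_iff.2 (eq_zero_of_le (by omega) h2.symm))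
  have hfin : ((fun x : tateT H π => x.1.1 (m + 1 : ℕ)) '' P).Finite := by
    refine (hZ.finite_torsion (m + 1)).subset ?_
    rintro _ ⟨x, -, rfl⟩
    have h := tateV_pow_smul x.1 (m + 1) 0
    rw [zero_add] at h
    exact h.trans (x.2 0 le_rfl)
  obtain ⟨_, ⟨e, he, rfl⟩, hmin⟩ := Set.exists_min_image _ Points.size hfin (hP.image _)
  refine ⟨e, he, fun y hy => Filter.eventually_atTop.2 ⟨m + 1, fun k hk => ?_⟩⟩
  induction k, hk using Nat.le_induction with
  | base => exact hmin _ ⟨y, hy, rfl⟩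
  | succ k hk ih =>
    have h1 := hlarge e he (k + 1) (by omega)
    have h2 := hlarge y hy (k + 1) (by omega)
    rw [Nat.cast_succ] at h1 h2 ⊢
    rw [hZ.size_apply_eq_pow hδ h1, hZ.size_apply_eq_pow hδ h2] at ih
    exact (pow_le_pow_iff_left₀ bot_le bot_le (by omega)).1 ih

/-- The Tate module and the large steps of the filtration lie in a common apartment. The elements of
the Tate module are compared by the sizes of their components of large index. A multiple of a basis
vector that is at most `x` in this sense lies in every large step that contains `x`, because a large
step is `π ^ k` times another one for every `k`, so that membership in it can be read off from the
component of index `k`. -/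
theorem exists_basis_diagLattice (hZ : IsKernel π Z) (hδ : ∀ z ∈ Z, z.size ≤ δ) (hδ1 : δ < 1)
    (hcard : 1 < Z.card) [IsDiscreteValuationRing (Valued.integer F)]
    [Module.Finite (Valued.integer F) (tateT H π)] {n : ℕ}
    (hn : Module.finrank (Valued.integer F) (tateT H π) = n) :
    ∃ e : Module.Basis (Fin n) F (tateV H π), tateT H π = diagLattice π.1 e (fun _ => 0) ∧
      ∀ r, δ ≤ r → r < 1 → ∃ a, normFil H π r = diagLattice π.1 e a := by
  have _ := isLattice_tateT (H := H) (π := π)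
  have hfree : Module.Free (Valued.integer F) (tateT H π) := Submodule.IsLattice.free F _
  obtain ⟨b, hb⟩ := exists_basis_forall_rel (T := tateT H π) π.2 n hn
    (fun x y => ∀ᶠ k : ℕ in Filter.atTop, (x.1.1 k).size ≤ (y.1.1 k).size)
    (fun c x => Filter.Eventually.of_forall fun k => Points.size_smul_le c _)
    (fun x y z hx hy => by
      filter_upwards [hx, hy] with k h1 h2
      exact (Points.size_add_le _ _).trans (max_le h1 h2))
    (fun x y hxy => by
      obtain ⟨N, hN⟩ := Filter.eventually_atTop.1 hxy
      refine Filter.eventually_atTop.2 ⟨N + 1, fun k hk => ?_⟩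
      obtain ⟨j, rfl⟩ := Nat.exists_eq_add_of_le' (show 1 ≤ k by omega)
      change ((π.1 • x.1).1 _).size ≤ ((π.1 • y.1).1 _).size
      rw [smul_tateV_apply, smul_tateV_apply, Nat.cast_add, Nat.cast_one, add_sub_cancel_right]
      exact hN j (by omega))
    (fun x y z hx hy => by
      filter_upwards [hx, hy] with k h1 h2
      exact h1.trans h2)
    (fun P hP hprim => hZ.exists_eventually_size_le hδ hδ1 hcard hP hprim)
  let e := b.extendOfIsLattice F
  have he : ∀ i, e i = (b i).1 := fun i => b.extendOfIsLattice_apply F i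
  have hT : tateT H π = diagLattice π.1 e (fun _ => 0) := by
    rw [diagLattice]
    simp only [zpow_zero, one_smul, he]
    have h := congrArg (Submodule.map (tateT H π).subtype) b.span_eq
    rw [Submodule.map_span, Submodule.map_subtype_top, ← Set.range_comp] at h
    exact h.symm
  refine ⟨e, hT, fun r hr hr1 => ?_⟩
  obtain ⟨m, hm⟩ := hZ.exists_normFil_le hcard hr1
  refine exists_eq_diagLattice π.2 e (fun x hx i => ?_) (hT ▸ tateT_le_normFil r)
    (l := 0 + -(m : ℤ)) (by rwa [← unif_zpow_smul_diagLattice π.2, ← hT])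
  have hxm := hm hx
  rw [mem_unif_zpow_smul_iff, neg_neg] at hxm
  obtain ⟨c, hc, hrel⟩ := hb ⟨_, hxm⟩
  have hc' : unif F π.2 ^ (m : ℤ) • x = ∑ i, c i • e i := by
    have h := congrArg Subtype.val hc
    simp only [AddSubmonoidClass.coe_finsetSum, SetLike.val_smul] at h
    simp only [he]
    exact h
  have hcomp : unif F π.2 ^ (m : ℤ) • (e.repr x i • e i) = c i • e i := by
    have h : e.repr (unif F π.2 ^ (m : ℤ) • x) i = algebraMap (Valued.integer F) F (c i) := by
      rw [hc', Finset.sum_congr rfl fun j _ => (algebraMap_smul F (c j) (e j)).symm]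
      exact congrFun (e.repr_sum_self fun j => algebraMap (Valued.integer F) F (c j)) i
    rw [Units.smul_def, map_smul, Finsupp.smul_apply, smul_eq_mul] at h
    rw [Units.smul_def, smul_smul, h, algebraMap_smul]
  obtain ⟨N, hN⟩ := Filter.eventually_atTop.1 (hrel i)
  obtain ⟨s, -, -, hs⟩ := hZ.exists_unif_pow_smul_normFil_eq hδ hcard N hr hr1
  rw [← hs, mem_unif_zpow_smul_iff, mem_normFil, unif_zpow_smul_apply] at hx ⊢
  refine le_trans ?_ hx
  have h1 := hN (N + m) (by omega)
  have h2 : ((c i • b i : tateT H π) : tateV H π) = unif F π.2 ^ (m : ℤ) • (e.repr x i • e i) := by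
    rw [hcomp, he]; rfl
  rw [h2, unif_zpow_smul_apply, unif_zpow_smul_apply] at h1
  convert h1 using 3 <;> simp

end IsKernel

end Apartment

/-! ### The vertices of the filtration -/

section Vertices

open scoped Pointwise

variable {F K : Type*} [NontriviallyNormedField F] [IsUltrametricDist F]
  [NontriviallyNormedField K] [IsUltrametricDist K] [NormedAlgebra F K]
  {H : FormalModule (Valued.integer F) (Valued.integer K)} {π : Uniformizer F} [CompleteSpace K]
  {Z : Finset (Points H)} {δ : ℝ≥0}

theorem normFil_lt_normFil {r s : ℝ≥0} (hrs : r < s) {x : tateV H π} (hx : (x.1 0).size = s) :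
    normFil H π r < normFil H π s :=
  lt_of_le_of_ne (normFil_mono hrs.le) fun h => by
    have h1 : x ∈ normFil H π r := h ▸ hx.le
    exact (hx ▸ h1 : s ≤ r).not_gt hrs

namespace IsKernel

theorem iterate_renumber_lt_one (hZ : IsKernel π Z) (hcard : 1 < Z.card) {r : ℝ≥0} (hr : r < 1)
    (k : ℕ) : (renumber Z)^[k] r < 1 := by
  obtain ⟨c₀, -, hc1, hc⟩ := exists_forall_size_le Z
  have hcc : max c₀ r < 1 := max_lt hc1 hr
  have h := hZ.iterate_renumber_le hcard (fun z hz => (hc z hz).trans (le_max_left _ _)) hcc.le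
    (le_max_right c₀ r) k
  exact h.trans_lt ((mul_le_of_le_one_left' (pow_le_one₀ bot_le hcc.le)).trans_lt hr)

theorem cls_normFil_pow (hZ : IsKernel π Z) (hδ : ∀ z ∈ Z, z.size ≤ δ) {r : ℝ≥0} (hr : δ ≤ r) :
    cls F (normFil H π (r ^ Z.card)) = cls F (normFil H π r) := by
  rw [← hZ.unif_smul_normFil hδ hr, cls_smul]

/-- The components of index `0` of elements of the rational Tate module, that is, the torsion
points, come arbitrarily close to the boundary of the unit disc. -/
theorem exists_lt_size_apply_zero (hZ : IsKernel π Z) (hδ1 : δ < 1) (hcard : 1 < Z.card)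
    (hsurj : ∀ y : Points H, ∃ x : Points H, π.1 • x = y) :
    ∃ x : tateV H π, δ < (x.1 0).size := by
  obtain ⟨z, hz, hz0⟩ := Finset.exists_mem_ne hcard 0
  obtain ⟨x, rfl⟩ := exists_tateV_apply_zero_eq hsurj (k := 1) (y := z)
    (by rw [pow_one]; exact (hZ.mem_iff z).1 hz)
  obtain ⟨m, hm⟩ := hZ.exists_pow_smul_eq_zero hcard hδ1
  refine ⟨unif F π.2 ^ (-(m : ℤ)) • x, ?_⟩
  rw [unif_zpow_smul_apply, sub_neg_eq_add]
  by_contra! hle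
  obtain ⟨k, hk⟩ := exists_pow_smul_apply_eq_zero x (0 + m)
  have h := hm k _ hk hle
  rw [tateV_pow_smul] at h
  exact hz0 h

/-- Up to homothety, the large steps of the filtration are those with index in a fundamental
domain `[δ', η[` for the map `r ↦ r ^ Q`, where `Q` is the order of the kernel. -/
theorem exists_cls_normFil_eq (hZ : IsKernel π Z) (hδ : ∀ z ∈ Z, z.size ≤ δ) (hδ0 : 0 < δ)
    (hcard : 1 < Z.card) {δ' η : ℝ≥0} (hδ' : δ ≤ δ') (hδ'1 : δ' < 1) (hη0 : 0 < η)
    (hη : η ^ Z.card = δ') {r : ℝ≥0} (hr : δ ≤ r) (hr1 : r < 1) :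
    ∃ s, δ' ≤ s ∧ s < η ∧ cls F (normFil H π s) = cls F (normFil H π r) := by
  obtain ⟨t, ht, ht1, he⟩ : ∃ t, δ' ≤ t ∧ t < 1 ∧
      cls F (normFil H π t) = cls F (normFil H π r) := by
    have key : ∀ (j : ℕ) (r : ℝ≥0), δ ≤ r → r < 1 → δ' ^ Z.card ^ j ≤ r → ∃ t, δ' ≤ t ∧ t < 1 ∧
        cls F (normFil H π t) = cls F (normFil H π r) := fun j => by
      induction j with
      | zero => intro r _ hr1 h; exact ⟨r, by simpa using h, hr1, rfl⟩
      | succ j ih =>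
        intro r hr hr1 h
        obtain ⟨s, hs, hs1, rfl, -⟩ := hZ.exists_unif_smul_normFil_eq hδ hcard hr hr1
        rw [pow_succ, pow_mul, pow_le_pow_iff_left₀ bot_le bot_le (by omega)] at h
        obtain ⟨t, ht, ht1, he⟩ := ih s hs hs1 h
        exact ⟨t, ht, ht1, by rw [he, hZ.cls_normFil_pow hδ hs]⟩
    obtain ⟨j, hj⟩ := exists_pow_lt_of_lt_one (hδ0.trans_le hr) hδ'1
    exact key j r hr hr1 ((pow_le_pow_of_le_one bot_le hδ'1.le
      (Nat.lt_pow_self hcard).le).trans hj.le)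
  rw [← he]
  have key : ∀ (j : ℕ) (t : ℝ≥0), δ' ≤ t → t ^ Z.card ^ j < η → ∃ s, δ' ≤ s ∧ s < η ∧
      cls F (normFil H π s) = cls F (normFil H π t) := fun j => by
    induction j with
    | zero => intro t ht h; exact ⟨t, ht, by simpa using h, rfl⟩
    | succ j ih =>
      intro t ht h
      rcases lt_or_ge t η with hlt | hge
      · exact ⟨t, ht, hlt, rfl⟩
      · obtain ⟨s, hs, hsη, he⟩ := ih (t ^ Z.card) (hη ▸ pow_le_pow_left₀ bot_le hge _)
          (by rwa [← pow_mul, ← pow_succ'])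
        exact ⟨s, hs, hsη, by rw [he, hZ.cls_normFil_pow hδ (hδ'.trans ht)]⟩
  obtain ⟨j, hj⟩ := exists_pow_lt_of_lt_one hη0 ht1
  exact key j t ht ((pow_le_pow_of_le_one bot_le ht1.le (Nat.lt_pow_self hcard).le).trans_lt hj)

/-- The large steps of the filtration form a simplex. The fundamental domain is chosen to start at
the size of a torsion point, so that all inclusions are strict. -/
theorem isSimplex (hZ : IsKernel π Z) (hδ : ∀ z ∈ Z, z.size ≤ δ) (hδ0 : 0 < δ) (hδ1 : δ < 1)
    (hcard : 1 < Z.card) (hsurj : ∀ y : Points H, ∃ x : Points H, π.1 • x = y)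
    [IsDiscreteValuationRing (Valued.integer F)]
    [Module.Finite (Valued.integer F) (tateT H π)] :
    IsSimplex π.1 {x | ∃ r, δ ≤ r ∧ r < 1 ∧ x = cls F (normFil H π r)} := by
  classical
  obtain ⟨x₀, hx₀⟩ := hZ.exists_lt_size_apply_zero hδ1 hcard hsurj
  set δ' := (x₀.1 0).size with hδ'
  set η := (x₀.1 1).size with hη'
  have hδ'1 : δ' < 1 := Points.size_lt_one _
  have hη1 : η < 1 := Points.size_lt_one _
  have hδ'0 : 0 < δ' := hδ0.trans hx₀
  have hle : δ' ≤ η := by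
    rw [hδ', ← x₀.2.1 0]
    exact Points.size_smul_le _ _
  have hη : η ^ Z.card = δ' := (hZ.size_apply_eq_pow hδ (x := x₀) (i := 0) (hx₀.trans_le hle)).symm
  have hη0 : 0 < η := hδ'0.trans_le hle
  have hlt : δ' < η := by
    rw [← hη]
    exact pow_lt_self_of_lt_one₀ hη0 hη1 hcard
  obtain ⟨m, hm⟩ := hZ.exists_pow_smul_eq_zero hcard hη1
  -- the sizes of torsion points in the fundamental domain
  let D : Finset ℝ≥0 := ((hZ.finite_torsion m).toFinset.image Points.size).filter
    fun r => δ' ≤ r ∧ r < η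
  have hD : ∀ {r : ℝ≥0}, r ∈ D ↔ (∃ x : tateV H π, (x.1 0).size = r) ∧ δ' ≤ r ∧ r < η := by
    intro r
    rw [Finset.mem_filter]
    refine and_congr_left fun hr => ⟨fun h => ?_, fun ⟨x, hx⟩ => ?_⟩
    · obtain ⟨y, hy, hyr⟩ := Finset.mem_image.1 h
      obtain ⟨x, rfl⟩ := exists_tateV_apply_zero_eq hsurj (k := m) (y := y) (by simpa using hy)
      exact ⟨x, hyr⟩
    · obtain ⟨k, hk⟩ := exists_pow_smul_apply_eq_zero x 0
      exact Finset.mem_image.2 ⟨x.1 0, by simpa using hm k _ hk (hx ▸ hr.2.le), hx⟩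
  have hδD : δ' ∈ D := hD.2 ⟨⟨x₀, rfl⟩, le_rfl, hlt⟩
  obtain ⟨d, hd⟩ : ∃ d, D.card = d + 1 :=
    Nat.exists_eq_succ_of_ne_zero (Finset.card_pos.2 ⟨_, hδD⟩).ne'
  let f := D.orderEmbOfFin hd
  have hf : ∀ i, f i ∈ D := D.orderEmbOfFin_mem hd
  have hstrict : ∀ {r i}, r < f i → normFil H π r < normFil H π (f i) := fun {r i} h => by
    obtain ⟨x, hx⟩ := (hD.1 (hf i)).1
    exact normFil_lt_normFil h hx
  refine ⟨d, fun i => normFil H π (f i.rev), fun i => ?_, fun i j hij => ?_, ?_, ?_⟩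
  · exact hZ.isLattice_normFil hcard ((hD.1 (hf _)).2.2.trans hη1)
  · exact hstrict (f.strictMono (Fin.rev_lt_rev.2 hij))
  · rw [smul_eq_unif_smul (F := F) π.2, hZ.unif_smul_normFil hδ (hx₀.le.trans (hD.1 (hf _)).2.1)]
    refine hstrict (lt_of_lt_of_le ?_ (hD.1 (hf _)).2.1)
    rw [← hη]
    exact pow_lt_pow_left₀ (hD.1 (hf _)).2.2 bot_le (by omega)
  · ext v
    constructor
    · rintro ⟨r, hr, hr1, rfl⟩
      obtain ⟨s, hs, hsη, he⟩ := hZ.exists_cls_normFil_eq (H := H) hδ hδ0 hcard hx₀.le hδ'1 hη0 hη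
        hr hr1
      -- the step of index `s` is that of the largest size of a torsion point not exceeding `s`
      obtain ⟨t, ht, hmax⟩ := Finset.exists_max_image (D.filter (· ≤ s)) id
        ⟨δ', Finset.mem_filter.2 ⟨hδD, hs⟩⟩
      obtain ⟨htD, hts⟩ := Finset.mem_filter.1 ht
      have hst : normFil H π s = normFil H π t := by
        refine le_antisymm (fun x hx => ?_) (normFil_mono hts)
        rcases lt_or_ge (x.1 0).size δ' with h | h
        · exact h.le.trans (hD.1 htD).2.1
        · exact hmax _ (Finset.mem_filter.2 ⟨hD.2 ⟨⟨x, rfl⟩, h, lt_of_le_of_lt hx hsη⟩, hx⟩)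
      obtain ⟨i, hi⟩ : t ∈ Set.range f := by
        rw [Finset.range_orderEmbOfFin]
        exact htD
      refine ⟨i.rev, ?_⟩
      beta_reduce
      rw [Fin.rev_rev, hi, ← hst, he]
    · rintro ⟨i, rfl⟩
      exact ⟨_, hx₀.le.trans (hD.1 (hf _)).2.1, (hD.1 (hf _)).2.2.trans hη1, rfl⟩

/-- The steps of the filtration are, up to homothety, the sums of the homothetic lattices of a
large step and of the Tate module. -/
theorem iUnion_vee_eq (hZ : IsKernel π Z) (hδ : ∀ z ∈ Z, z.size ≤ δ) (hδ1 : δ < 1)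
    (hcard : 1 < Z.card) (hsurj : ∀ y : Points H, ∃ x : Points H, π.1 • x = y)
    [IsDiscreteValuationRing (Valued.integer F)] :
    {x | ∃ r < 1, x = cls F (normFil H π r)} =
      ⋃ x ∈ {x | ∃ r, δ ≤ r ∧ r < 1 ∧ x = cls F (normFil H π r)}, vee x (cls F (tateT H π)) := by
  ext v
  simp only [Set.mem_iUnion, exists_prop]
  constructor
  · rintro ⟨r, hr1, rfl⟩
    rcases eq_or_ne r 0 with rfl | hr0
    · obtain ⟨m, hm⟩ := hZ.exists_normFil_le hcard hδ1
      refine ⟨_, ⟨δ, le_rfl, hδ1, rfl⟩, unif F π.2 ^ (m : ℤ) • normFil H π δ, tateT H π,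
        cls_smul _ _, rfl, ?_⟩
      rw [normFil_zero, sup_eq_right.2]
      rwa [← units_smul_le_units_smul_iff (a := unif F π.2 ^ (-(m : ℤ))), smul_smul, ← zpow_add,
        neg_add_cancel, zpow_zero, one_smul]
    · obtain ⟨k, s, hs, hs1, rfl⟩ :=
        hZ.exists_iterate_renumber_eq hcard hδ1 (pos_iff_ne_zero.2 hr0) hr1
      refine ⟨_, ⟨s, hs, hs1, rfl⟩, unif F π.2 ^ k • normFil H π s, tateT H π, cls_smul _ _,
        rfl, ?_⟩
      rw [hZ.unif_pow_smul_normFil_sup hsurj]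
  · rintro ⟨_, ⟨r, hr, hr1, rfl⟩, L₁, L₂, h₁, h₂, rfl⟩
    obtain ⟨k, rfl⟩ := (cls_eq_iff_zpow π.2).1 h₁
    obtain ⟨l, rfl⟩ := (cls_eq_iff_zpow π.2).1 h₂
    have hsum : cls F (unif F π.2 ^ k • normFil H π r ⊔ unif F π.2 ^ l • tateT H π) =
        cls F (unif F π.2 ^ (k - l) • normFil H π r ⊔ tateT H π) := by
      rw [← cls_smul (unif F π.2 ^ l) (unif F π.2 ^ (k - l) • normFil H π r ⊔ tateT H π),
        units_smul_sup, smul_smul, ← zpow_add, add_sub_cancel]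
    rw [hsum]
    obtain ⟨j, hj | hj⟩ := Int.eq_nat_or_neg (k - l)
    · refine ⟨_, hZ.iterate_renumber_lt_one hcard hr1 j, ?_⟩
      rw [hj, zpow_natCast, hZ.unif_pow_smul_normFil_sup hsurj]
    · obtain ⟨s, -, hs1, hs⟩ := hZ.exists_unif_pow_smul_normFil_eq hδ hcard j hr hr1
      refine ⟨s, hs1, ?_⟩
      rw [hj, ← hs, smul_smul, ← zpow_add, neg_add_cancel, zpow_zero, one_smul,
        sup_eq_left.2 (tateT_le_normFil s)]

end IsKernel

end Vertices

end LubinTate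

end

theorem mainTheorem4 (p : ℕ) [Fact p.Prime] {F K : Type*}
    [NontriviallyNormedField F] [IsUltrametricDist F] [NormedAlgebra ℚ_[p] F]
    [FiniteDimensional ℚ_[p] F]
    [NontriviallyNormedField K] [IsUltrametricDist K] [NormedAlgebra F K] [CompleteSpace K]
    [IsAlgClosed K]
    (π : LubinTate.Uniformizer F)
    (H : LubinTate.FormalModule (Valued.integer F) (Valued.integer K))
    (n : ℕ) (hn : LubinTate.HasHeight H π n) :
    (∀ t : EReal, 0 < t → (LubinTate.fil H π t).IsLattice F) ∧
    LubinTate.fil H π ⊤ = LubinTate.tateT H π ∧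
    (∃ ε : ℝ, 0 < ε ∧ LubinTate.IsSmall H π ε) ∧
    ∀ ε : ℝ, 0 < ε → LubinTate.IsSmall H π ε →
      LubinTate.IsSimplex π.1 (LubinTate.smallVertices H π ε) ∧
      LubinTate.ramificationVertices H π =
        ⋃ x ∈ LubinTate.smallVertices H π ε,
          LubinTate.vee x (LubinTate.cls F (LubinTate.tateT H π)) ∧
      (∃ e : Module.Basis (Fin n) F (LubinTate.tateV H π),
        LubinTate.smallVertices H π ε ∪ {LubinTate.cls F (LubinTate.tateT H π)} ⊆
          LubinTate.apartment π.1 e) ∧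
      ∀ e : Module.Basis (Fin n) F (LubinTate.tateV H π),
        LubinTate.smallVertices H π ε ∪ {LubinTate.cls F (LubinTate.tateT H π)} ⊆
            LubinTate.apartment π.1 e →
          LubinTate.ramificationVertices H π ⊆
            LubinTate.enclos π.1 e
              (LubinTate.smallVertices H π ε ∪ {LubinTate.cls F (LubinTate.tateT H π)}) := by
  open LubinTate IsLocalRing in
  obtain ⟨hdvr, hF⟩ := isDiscreteValuationRing_and_completeSpace p F
  have hsurj : ∀ y : Points H, ∃ x : Points H, π.1 • x = y := Points.exists_smul_eq hn
  obtain ⟨Z, hZ, hZn⟩ := exists_isKernel hn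
  have hcard : 1 < Z.card := hZn ▸ hn.one_lt
  have hfin := hZ.finite_tateT hsurj
  have hlat := isLattice_tateT (H := H) (π := π)
  have hfree : Module.Free (Valued.integer F) (tateT H π) := Submodule.IsLattice.free F _
  have hrank := hZ.finrank_tateT hsurj hZn hcard
  refine ⟨fun t ht => ?_, fil_top, ?_, fun ε hε hsmall => ?_⟩
  · obtain ⟨r, hr, h⟩ := exists_normFil_eq (H := H) (π := π) ht
    exact h ▸ hZ.isLattice_normFil hcard hr
  · obtain ⟨δ, hδ0, hδ1, hδ⟩ := exists_forall_size_le Z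
    obtain ⟨ε, rfl⟩ := exists_rpow_eq hδ0 π
    refine ⟨ε, ?_, (isSmall_iff hsurj hZ).2 hδ⟩
    by_contra! h
    exact (NNReal.one_le_rpow_of_pos_of_le_one_of_nonpos (norm_uniformizer_pos π)
      (norm_uniformizer_lt_one π).le h).not_gt hδ1
  · have hδ := (isSmall_iff hsurj hZ).1 hsmall
    have hδ0 : 0 < ‖π.1‖₊ ^ ε := NNReal.rpow_pos (norm_uniformizer_pos π)
    have hδ1 : ‖π.1‖₊ ^ ε < 1 := NNReal.rpow_lt_one (norm_uniformizer_lt_one π) hε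
    have hvee : ramificationVertices H π =
        ⋃ x ∈ smallVertices H π ε, vee x (cls F (tateT H π)) := by
      rw [ramificationVertices_eq, smallVertices_eq]
      exact hZ.iUnion_vee_eq hδ hδ1 hcard hsurj
    refine ⟨?_, hvee, ?_, fun e he v hv => ?_⟩
    · rw [smallVertices_eq]
      exact hZ.isSimplex hδ hδ0 hδ1 hcard hsurj
    · obtain ⟨e, hT, he⟩ := hZ.exists_basis_diagLattice hδ hδ1 hcard hrank
      refine ⟨e, ?_⟩
      rw [smallVertices_eq]
      rintro _ (⟨r, hr, hr1, rfl⟩ | rfl)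
      · obtain ⟨a, ha⟩ := he r hr hr1
        exact ⟨a, by rw [ha]⟩
      · exact ⟨fun _ => 0, congrArg (cls F) hT.symm⟩
    · rw [hvee] at hv
      simp only [Set.mem_iUnion, exists_prop] at hv
      obtain ⟨x, hx, L₁, L₂, rfl, h₂, rfl⟩ := hv
      exact cls_sup_mem_enclos π.2 he (Or.inl hx) (Or.inr h₂)
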